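/- Let $G$ be a connected reductive linear algebraic group over $\mathbb{C}$ with Lie algebra $\mathfrak{g}$, and let $V$ be a finite-dimensional rational representation of $G$. For $v \in V$ with closed orbit $G\cdot v$, put $\mathfrak{c}_v = \{x \in V : \mathfrak{g}\cdot x \subseteq \mathfrak{g}\cdot v\}$; a subspace $C \subseteq V$ is called a Cartan subspace if $C = \mathfrak{c}_v$ for some such $v$ and $\dim C = \dim V/\!/G$, and the representation is called polar if it has a Cartan subspace. Assume that $V$ is polar with Cartan subspace $C$, and that it is stable, i.e. $\dim C + \dim \mathfrak{g}\cdot C = \dim V$, where $\mathfrak{g}\cdot C$ is the span of all $X\cdot c$ with $X \in \mathfrak{g}$, $c \in C$. Let $Z_G(C) = \{g \in G : g\cdot c = c \text{ for all } c \in C\}$, let $Z_G(C)^0$ be its identity component, and let $I = Z_G(C)/Z_G(C)^0$. Then for every $g \in Z_G(C)$ the determinant of $g$ acting on $V$ satisfies $\det(g) = \pm 1$. Moreover, the determinant character descends to $I$: there is a unique group homomorphism $\tau : I \to \{\pm 1\}$ such that $\tau(g\, Z_G(C)^0) = \det(g)$ for all $g \in Z_G(C)$. -/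

import Mathlib

open Matrix

noncomputable section

namespace PolarRep

/-- The Zariski topology on `GL_n(ℂ)`: the sets `{g | p(g) ≠ 0}`, for `p` a polynomial in the
matrix entries, form a basis of open sets. -/
@[reducible]
def zariski (n : ℕ) : TopologicalSpace (GL (Fin n) ℂ) :=
  TopologicalSpace.generateFrom
    {U | ∃ p : MvPolynomial (Fin n × Fin n) ℂ,
      U = {g : GL (Fin n) ℂ | MvPolynomial.eval (fun ij => g.1 ij.1 ij.2) p ≠ 0}}

theorem zariski_continuous_mul_left {n : ℕ} (a : GL (Fin n) ℂ) :
    @Continuous _ _ (zariski n) (zariski n) (fun g => a * g) := by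
  let := zariski n
  refine continuous_generateFrom_iff.2 ?_
  rintro U ⟨p, rfl⟩
  refine TopologicalSpace.isOpen_generateFrom_of_mem
    ⟨MvPolynomial.bind₁ (fun ij : Fin n × Fin n =>
      ∑ k, MvPolynomial.C (a.1 ij.1 k) * MvPolynomial.X (k, ij.2)) p, ?_⟩
  ext g
  have key : ∀ (x : Fin n × Fin n → ℂ) (f : Fin n × Fin n → MvPolynomial (Fin n × Fin n) ℂ),
      MvPolynomial.eval x (MvPolynomial.bind₁ f p) =
        MvPolynomial.eval (fun i => MvPolynomial.eval x (f i)) p :=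
    fun x f => MvPolynomial.eval₂Hom_bind₁ (RingHom.id ℂ) x f p
  simp only [Set.mem_preimage, Set.mem_ofPred_eq, key]
  simp [Matrix.mul_apply]

theorem zariski_continuous_mul_right {n : ℕ} (a : GL (Fin n) ℂ) :
    @Continuous _ _ (zariski n) (zariski n) (fun g => g * a) := by
  let := zariski n
  refine continuous_generateFrom_iff.2 ?_
  rintro U ⟨p, rfl⟩
  refine TopologicalSpace.isOpen_generateFrom_of_mem
    ⟨MvPolynomial.bind₁ (fun ij : Fin n × Fin n =>
      ∑ k, MvPolynomial.X (ij.1, k) * MvPolynomial.C (a.1 k ij.2)) p, ?_⟩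
  ext g
  have key : ∀ (x : Fin n × Fin n → ℂ) (f : Fin n × Fin n → MvPolynomial (Fin n × Fin n) ℂ),
      MvPolynomial.eval x (MvPolynomial.bind₁ f p) =
        MvPolynomial.eval (fun i => MvPolynomial.eval x (f i)) p :=
    fun x f => MvPolynomial.eval₂Hom_bind₁ (RingHom.id ℂ) x f p
  simp only [Set.mem_preimage, Set.mem_ofPred_eq, key]
  simp [Matrix.mul_apply]

theorem mul_mem_component {n : ℕ} (H : Subgroup (GL (Fin n) ℂ)) {a b c : GL (Fin n) ℂ}
    (ha : a ∈ H) (hb : b ∈ @connectedComponentIn _ (zariski n) H 1)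
    (hc : c ∈ @connectedComponentIn _ (zariski n) H 1)
    (hab : a * b ∈ @connectedComponentIn _ (zariski n) H 1) :
    a * c ∈ @connectedComponentIn _ (zariski n) H 1 := by
  let := zariski n
  rw [connectedComponentIn_eq hab]
  refine (isPreconnected_connectedComponentIn.image (fun g => a * g)
    (zariski_continuous_mul_left a).continuousOn).subset_connectedComponentIn
    ⟨b, hb, rfl⟩ ?_ ⟨c, hc, rfl⟩
  rintro _ ⟨g, hg, rfl⟩
  exact H.mul_mem ha (connectedComponentIn_subset _ _ hg)

/-- The identity component `H⁰` of a subgroup `H` of `GL_n(ℂ)`: the connected component of `1`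
in `H` for the Zariski topology. -/
def identityComponent {n : ℕ} (H : Subgroup (GL (Fin n) ℂ)) : Subgroup H where
  carrier := {h | (h : GL (Fin n) ℂ) ∈ @connectedComponentIn _ (zariski n) H 1}
  one_mem' := @mem_connectedComponentIn _ (zariski n) _ _ H.one_mem
  mul_mem' := by
    intro a b ha hb
    exact mul_mem_component H a.2 (@mem_connectedComponentIn _ (zariski n) _ _ H.one_mem) hb
      (by simpa using ha)
  inv_mem' := by
    intro a ha
    have h1 := @mem_connectedComponentIn _ (zariski n) _ _ H.one_mem
    simpa using mul_mem_component H (H.inv_mem a.2) ha h1 (by simpa using h1)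

instance identityComponent_normal {n : ℕ} (H : Subgroup (GL (Fin n) ℂ)) :
    (identityComponent H).Normal where
  conj_mem := by
    intro h hh g
    let := zariski n
    have hcont : Continuous (fun x : GL (Fin n) ℂ => (g : GL (Fin n) ℂ) * x * (g : GL (Fin n) ℂ)⁻¹) :=
      (zariski_continuous_mul_right _).comp (zariski_continuous_mul_left _)
    refine (isPreconnected_connectedComponentIn.image _
      hcont.continuousOn).subset_connectedComponentIn
      ⟨1, mem_connectedComponentIn H.one_mem, by simp⟩ ?_ ⟨h, hh, by simp⟩
    rintro _ ⟨x, hx, rfl⟩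
    exact H.mul_mem (H.mul_mem g.2 (connectedComponentIn_subset _ _ hx)) (H.inv_mem g.2)

/-- A representation of `G ≤ GL_n(ℂ)` is rational if its matrix coefficients are regular functions
on `G`, i.e. restrictions of functions of the form `p / det ^ k` with `p` a polynomial in the
matrix entries. -/
def IsRational {n : ℕ} {G : Subgroup (GL (Fin n) ℂ)} {V : Type*} [AddCommGroup V] [Module ℂ V]
    (ρ : Representation ℂ G V) : Prop :=
  ∀ (l : Module.Dual ℂ V) (v : V), ∃ (p : MvPolynomial (Fin n × Fin n) ℂ) (k : ℕ), ∀ g : G,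
    l (ρ g v) = MvPolynomial.eval (fun ij => (g : GL (Fin n) ℂ).1 ij.1 ij.2) p /
      (g : GL (Fin n) ℂ).1.det ^ k

/-- A linear algebraic group over `ℂ` is reductive if all its finite-dimensional rational
representations are completely reducible: every invariant subspace has an invariant complement. -/
def IsReductive {n : ℕ} (G : Subgroup (GL (Fin n) ℂ)) : Prop :=
  ∀ (m : ℕ) (ρ : Representation ℂ G (Fin m → ℂ)), IsRational ρ →
    ∀ P : Submodule ℂ (Fin m → ℂ), (∀ g : G, ∀ x ∈ P, ρ g x ∈ P) →
      ∃ Q : Submodule ℂ (Fin m → ℂ), (∀ g : G, ∀ x ∈ Q, ρ g x ∈ Q) ∧ IsCompl P Q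

/-- Connected reductive linear algebraic groups over `ℂ`, realized as Zariski closed subgroups of
`GL_n(ℂ)`. -/
structure IsConnectedReductiveGroup {n : ℕ} (G : Subgroup (GL (Fin n) ℂ)) : Prop where
  isClosed : @IsClosed _ (zariski n) (G : Set (GL (Fin n) ℂ))
  isConnected : @IsConnected _ (zariski n) (G : Set (GL (Fin n) ℂ))
  isReductive : IsReductive G

section Representation

variable {n : ℕ} {G : Subgroup (GL (Fin n) ℂ)} {V : Type*} [AddCommGroup V] [Module ℂ V]

/-- `𝔤 · v`, the span of the vectors `dρ(X) v` for `X ∈ 𝔤 = Lie(G)`.  Here `X ∈ 𝔤` means that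
`exp (t X) ∈ G` for all `t`; the one-parameter subgroup `t ↦ exp (t X)` of `G` is called `γ`, and
`w = dρ(X) v` is the derivative of `ρ (exp (t X)) v` at `t = 0`. -/
def lieOrbit (ρ : Representation ℂ G V) (v : V) : Submodule ℂ V :=
  Submodule.span ℂ {w | ∃ (X : Matrix (Fin n) (Fin n) ℂ) (γ : ℂ → G),
    (∀ t : ℂ, ((γ t : GL (Fin n) ℂ) : Matrix (Fin n) (Fin n) ℂ) = NormedSpace.exp (t • X)) ∧
    ∀ l : Module.Dual ℂ V, HasDerivAt (fun t : ℂ => l (ρ (γ t) v)) (l w) 0}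

variable (V) in
/-- The algebra `ℂ[V]` of polynomial functions on `V`, generated by the linear functions. -/
def polynomialFunctions : Subalgebra ℂ (V → ℂ) :=
  Algebra.adjoin ℂ (Set.range fun l : Module.Dual ℂ V => (l : V → ℂ))

/-- The algebra `ℂ[V]^G` of invariant polynomial functions, the coordinate ring of `V // G`. -/
def invariants (ρ : Representation ℂ G V) : Subalgebra ℂ (V → ℂ) where
  carrier := {f | f ∈ polynomialFunctions V ∧ ∀ (g : G) (x : V), f (ρ g x) = f x}
  mul_mem' := fun ha hb => ⟨mul_mem ha.1 hb.1, fun g x => by simp [ha.2 g x, hb.2 g x]⟩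
  add_mem' := fun ha hb => ⟨add_mem ha.1 hb.1, fun g x => by simp [ha.2 g x, hb.2 g x]⟩
  algebraMap_mem' := fun r => ⟨Subalgebra.algebraMap_mem _ r, fun _ _ => rfl⟩

/-- A vector is semisimple if its orbit is Zariski closed in `V`. -/
def IsSemisimpleVector (ρ : Representation ℂ G V) (v : V) : Prop :=
  ∃ S ⊆ (polynomialFunctions V : Set (V → ℂ)),
    Set.range (fun g : G => ρ g v) = {x | ∀ f ∈ S, f x = 0}

/-- `C` is a Cartan subspace of `V` (in the sense of Dadok and Kac): for some semisimple `v`,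
`C = {x | 𝔤 · x ⊆ 𝔤 · v}` and `dim C = dim V // G`.  The representation is polar if it has a
Cartan subspace. -/
def IsCartanSubspace (ρ : Representation ℂ G V) (C : Submodule ℂ V) : Prop :=
  ∃ v : V, IsSemisimpleVector ρ v ∧ (C : Set V) = {x | lieOrbit ρ x ≤ lieOrbit ρ v} ∧
    (Module.finrank ℂ C : WithBot ℕ∞) = ringKrullDim (invariants ρ)

/-- The stability condition `dim C + dim 𝔤 · C = dim V`. -/
def IsStable (ρ : Representation ℂ G V) (C : Submodule ℂ V) : Prop :=
  Module.finrank ℂ C + Module.finrank ℂ (⨆ c ∈ C, lieOrbit ρ c : Submodule ℂ V) =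
    Module.finrank ℂ V

/-- `Z_G(C)`, the pointwise stabilizer of `C` in `G`, as a subgroup of `GL_n(ℂ)`. -/
def centralizer (ρ : Representation ℂ G V) (C : Submodule ℂ V) : Subgroup (GL (Fin n) ℂ) :=
  Subgroup.map G.subtype
    { carrier := {g : G | ∀ c ∈ C, ρ g c = c}
      one_mem' := fun c _ => by simp
      mul_mem' := fun {a b} ha hb c hc => by
        rw [map_mul, Module.End.mul_apply, hb c hc, ha c hc]
      inv_mem' := fun {a} ha c hc => by
        have h : ρ a⁻¹ (ρ a c) = c := by
          rw [← Module.End.mul_apply, ← map_mul, inv_mul_cancel, map_one, Module.End.one_apply]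
        rwa [ha c hc] at h }

/-- The component group `I = Z_G(C) / Z_G(C)⁰`. -/
abbrev inertia (ρ : Representation ℂ G V) (C : Submodule ℂ V) : Type :=
  centralizer ρ C ⧸ identityComponent (centralizer ρ C)

end Representation

end PolarRep

end

/-! Write `𝔨` for the image of the Lie algebra of `G` in `End V`, and let `C = 𝔠_v`. Suppose `V` has
a Hermitian inner product for which `𝔨` is closed under adjoints and `v ⟂ 𝔨 v`. For `x ∈ C` and `X ∈
𝔨` there is `Y ∈ 𝔨` with `X* x = Y v`, so `⟨x, X v⟩ = ⟨Y v, v⟩ = 0`: thus `C ⟂ 𝔨 v`. Since `𝔤 · C =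
𝔨 v`, stability gives `V = C ⊕ 𝔨 v`. An element `h` of `Z_G(C)` therefore has the same determinant
on `V` as on `𝔨 v ≅ 𝔨 / 𝔨_v`, which is `det (Ad h | 𝔨) / det (Ad h | 𝔨_v)`. Both `𝔨` and `𝔨_v` are
closed under adjoints, so the trace form is nondegenerate on each; it is `Ad h`-invariant, so both
determinants are `±1`. This is `det_eq_one_or_neg_one_of_selfAdjoint`.

The inner product comes from two minimisations in the style of Kempf and Ness, with complete
reducibility as the only input on reductive groups. Realize `G` as a closed group of matrices of
determinant one containing `ρ` as a block (`exists_matrixModel`). Its invariants under right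
translation are finitely generated (Hilbert) and separate the group from all other matrices, so the
Lie algebra consists of the matrices whose derivation `lieDer` kills every invariant. Translate the
generators by a matrix of determinant one to minimal Fischer norm. In the Fischer product the
adjoint of `lieDer B` is `lieDer Bᴴ`, so the first order condition along `[B, Bᴴ]` says `‖lieDer Bᴴ
f‖² = 0` (`exists_conjTranspose_mem_matLie`). A second minimisation, of the norm on the closed orbit
of `v`, gives the orthogonality of `v` to `𝔨 v` (`inner_euclid_eq_zero`).

For the identity component, `{det ≠ 1}` and `{det ≠ -1}` are Zariski open sets that cover `Z_G(C)`
and have no common point in it. -/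

noncomputable section

namespace PolarRep

/-! ### Determinants: isometries of bilinear forms and short exact sequences. -/

section Orthogonal

/-- An endomorphism preserving a nondegenerate bilinear form has determinant `±1`. -/
theorem det_eq_one_or_neg_one_of_preserves {K W : Type*} [Field K] [AddCommGroup W] [Module K W]
    [FiniteDimensional K W] (B : LinearMap.BilinForm K W) (hB : B.Nondegenerate) (T : W →ₗ[K] W)
    (hT : ∀ x y, B (T x) (T y) = B x y) : LinearMap.det T = 1 ∨ LinearMap.det T = -1 := by
  classical
  let b := Module.finBasis K W
  have h1 : B.comp T T = B := by
    ext x y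
    simp [hT]
  have h2 := congrArg (fun M => Matrix.det (LinearMap.BilinForm.toMatrix b M)) h1
  simp only [LinearMap.BilinForm.toMatrix_comp b b, Matrix.det_mul, Matrix.det_transpose,
    LinearMap.det_toMatrix] at h2
  have h3 := (LinearMap.BilinForm.nondegenerate_iff_det_ne_zero b).1 hB
  have h4 : (LinearMap.det T - 1) * (LinearMap.det T + 1) = 0 := by
    have : (LinearMap.det T * LinearMap.det T - 1) * Matrix.det (LinearMap.BilinForm.toMatrix b B)
        = 0 := by linear_combination h2
    rcases mul_eq_zero.1 this with h | h
    · linear_combination h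
    · exact absurd h h3
  rcases mul_eq_zero.1 h4 with h | h
  · exact Or.inl (sub_eq_zero.1 h)
  · exact Or.inr (eq_neg_of_add_eq_zero_left h)

/-- Multiplicativity of the determinant along `0 → U ∩ ker f → U → f(U) → 0`. -/
theorem det_restrict_eq_mul {K W V : Type*} [Field K] [AddCommGroup W] [Module K W]
    [AddCommGroup V] [Module K V] [FiniteDimensional K W] [FiniteDimensional K V]
    (T : W →ₗ[K] W) (h : V →ₗ[K] V) (f : W →ₗ[K] V) (hf : ∀ x, f (T x) = h (f x))
    (U : Submodule K W) (hU : U ≤ U.comap T)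
    (hN : U ⊓ LinearMap.ker f ≤ (U ⊓ LinearMap.ker f).comap T)
    (hS : U.map f ≤ (U.map f).comap h) :
    LinearMap.det (T.restrict hU) =
      LinearMap.det (T.restrict hN) * LinearMap.det (h.restrict hS) := by
  let ev : U →ₗ[K] V := f.comp U.subtype
  let N : Submodule K U := LinearMap.ker ev
  have hNst : N ≤ N.comap (T.restrict hU) := by
    rintro ⟨X, hX⟩ hXv
    exact (hN (show X ∈ U ⊓ LinearMap.ker f from ⟨hX, hXv⟩)).2
  rw [LinearMap.det_eq_det_mul_det N (T.restrict hU) hNst]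
  congr 1
  · let e : N ≃ₗ[K] (U ⊓ LinearMap.ker f : Submodule K W) :=
      { toFun := fun x => ⟨x.1.1, x.1.2, x.2⟩
        invFun := fun x => ⟨⟨x.1, x.2.1⟩, x.2.2⟩
        map_add' := fun _ _ => rfl
        map_smul' := fun _ _ => rfl
        left_inv := fun _ => rfl
        right_inv := fun _ => rfl }
    rw [← LinearMap.det_conj _ e]
    congr 1
  · have hrange : LinearMap.range ev = U.map f := by
      rw [LinearMap.range_comp, Submodule.range_subtype]
    let e : (U ⧸ N) ≃ₗ[K] U.map f := ev.quotKerEquivRange.trans (LinearEquiv.ofEq _ _ hrange)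
    rw [← LinearMap.det_conj _ e]
    congr 1
    refine LinearMap.ext fun s => ?_
    obtain ⟨q, rfl⟩ := e.surjective s
    obtain ⟨X, rfl⟩ := Submodule.Quotient.mk_surjective _ q
    apply Subtype.ext
    simp only [LinearMap.comp_apply, LinearEquiv.coe_coe, LinearEquiv.symm_apply_apply,
      Submodule.mapQ_apply]
    exact hf X

end Orthogonal

/-! ### The determinant argument for a Lie algebra closed under adjoints. -/

section SelfAdjoint

variable {V : Type*} [NormedAddCommGroup V] [InnerProductSpace ℂ V] [FiniteDimensional ℂ V]

/-- This trace is the sum of the `‖X b‖²` over an orthonormal basis. It makes the trace form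
nondegenerate on any space closed under adjoints. -/
theorem eq_zero_of_trace_mul_adjoint_eq_zero (X : Module.End ℂ V)
    (h : LinearMap.trace ℂ V (LinearMap.adjoint X * X) = 0) : X = 0 := by
  have b := stdOrthonormalBasis ℂ V
  rw [LinearMap.trace_eq_sum_inner _ b] at h
  have h2 : ∀ i, inner ℂ (b i) ((LinearMap.adjoint X * X) (b i)) = ((‖X (b i)‖ ^ 2 : ℝ) : ℂ) := by
    intro i
    rw [Module.End.mul_apply, LinearMap.adjoint_inner_right, inner_self_eq_norm_sq_to_K]
    simp
  simp_rw [h2] at h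
  rw [← Complex.ofReal_sum, Complex.ofReal_eq_zero,
    Finset.sum_eq_zero_iff_of_nonneg (fun _ _ => by positivity)] at h
  refine b.toBasis.ext fun i => ?_
  have := h i (Finset.mem_univ i)
  simpa using this

/-- Conjugation by an automorphism has determinant `±1` on every stable space of endomorphisms
which is closed under taking adjoints: it preserves the trace form. -/
theorem det_conj_restrict_eq (U : Submodule ℂ (Module.End ℂ V))
    (hU : ∀ X ∈ U, LinearMap.adjoint X ∈ U) (h : V ≃ₗ[ℂ] V)
    (hh : U ≤ U.comap (h.conj : Module.End ℂ V →ₗ[ℂ] Module.End ℂ V)) :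
    LinearMap.det ((h.conj : Module.End ℂ V →ₗ[ℂ] Module.End ℂ V).restrict hh) = 1 ∨
      LinearMap.det ((h.conj : Module.End ℂ V →ₗ[ℂ] Module.End ℂ V).restrict hh) = -1 := by
  let B : LinearMap.BilinForm ℂ (Module.End ℂ V) :=
    LinearMap.mk₂ ℂ (fun X Y => LinearMap.trace ℂ V (X * Y))
      (fun X Y Z => by simp [add_mul]) (fun c X Y => by simp)
      (fun X Y Z => by simp [mul_add]) (fun c X Y => by simp)
  refine det_eq_one_or_neg_one_of_preserves (B.restrict U) ?_ _ ?_
  · have hsep : ∀ x : U, (∀ y : U, B x y = 0) → x = 0 := by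
      intro x hx
      have := hx ⟨_, hU _ x.2⟩
      apply Subtype.ext
      apply eq_zero_of_trace_mul_adjoint_eq_zero
      rw [LinearMap.trace_mul_comm]
      exact this
    refine ⟨fun x hx => hsep x hx, fun x hx => hsep x fun y => ?_⟩
    have := hx y
    change LinearMap.trace ℂ V _ = 0
    rw [LinearMap.trace_mul_comm]
    exact this
  · rintro ⟨x, hx⟩ ⟨y, hy⟩
    change LinearMap.trace ℂ V (h.conj x * h.conj y) = LinearMap.trace ℂ V (x * y)
    rw [← LinearMap.trace_conj' (x * y) h]
    congr 1
    ext z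
    simp [LinearEquiv.conj_apply]

/-- Let `𝔨` be a Lie algebra of endomorphisms closed under adjoints, `v` a vector orthogonal to
`𝔨 v`, and `C` a space of complementary dimension of vectors `x` with `𝔨 x ⊆ 𝔨 v`. An automorphism
which normalizes `𝔨` and fixes `C` pointwise has determinant `±1`. -/
theorem det_eq_one_or_neg_one_of_selfAdjoint (𝔨 : Submodule ℂ (Module.End ℂ V))
    (hbr : ∀ X ∈ 𝔨, ∀ Y ∈ 𝔨, X * Y - Y * X ∈ 𝔨) (hadj : ∀ X ∈ 𝔨, LinearMap.adjoint X ∈ 𝔨)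
    (v : V) (hv : ∀ X ∈ 𝔨, inner ℂ v (X v) = 0) (C : Submodule ℂ V) (hvC : v ∈ C)
    (hC : ∀ x ∈ C, ∀ X ∈ 𝔨, ∃ Y ∈ 𝔨, X x = Y v)
    (hdim : Module.finrank ℂ C + Module.finrank ℂ (𝔨.map (LinearMap.applyₗ v)) =
      Module.finrank ℂ V)
    (h : V ≃ₗ[ℂ] V) (hh : ∀ X ∈ 𝔨, h.conj X ∈ 𝔨) (hfix : ∀ c ∈ C, h c = c) :
    LinearMap.det (h : V →ₗ[ℂ] V) = 1 ∨ LinearMap.det (h : V →ₗ[ℂ] V) = -1 := by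
  set S : Submodule ℂ V := 𝔨.map (LinearMap.applyₗ v)
  have hhv : h v = v := hfix v hvC
  have hhv_symm : h.symm v = v := by rw [LinearEquiv.symm_apply_eq, hhv]
  have hconj : ∀ X : Module.End ℂ V, h.conj X v = h (X v) := by
    intro X
    rw [LinearEquiv.conj_apply_apply, hhv_symm]
  -- `C` is orthogonal to `𝔨 v`
  have horth : ∀ x ∈ C, ∀ s ∈ S, inner ℂ x s = 0 := by
    rintro x hx _ ⟨X, hX, rfl⟩
    -- The defining property of `C` is applied to the adjoint of `X`, not to `X` itself.
    obtain ⟨Y, hY, hYv⟩ := hC x hx _ (hadj X hX)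
    change inner ℂ x (X v) = 0
    rw [← LinearMap.adjoint_inner_left, hYv, ← inner_conj_symm, hv Y hY, map_zero]
  have hdisj : Disjoint C S := by
    rw [Submodule.disjoint_def]
    intro x hx hs
    exact inner_self_eq_zero.1 (horth x hx x hs)
  have hcompl : IsCompl S C :=
    ⟨hdisj.symm, codisjoint_iff.2 (Submodule.eq_top_of_disjoint C S hdim.ge hdisj ▸
      sup_comm S C)⟩
  have hSst : S ≤ S.comap (h : V →ₗ[ℂ] V) := by
    rintro _ ⟨X, hX, rfl⟩
    exact ⟨_, hh X hX, hconj X⟩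
  rw [LinearMap.det_eq_det_mul_det S _ hSst]
  -- The quotient by `𝔨 v` is represented by `C`, which `h` fixes.
  have hquot : S.mapQ S (h : V →ₗ[ℂ] V) hSst = LinearMap.id := by
    ext x
    obtain ⟨s, hs, c, hc, rfl⟩ := Submodule.mem_sup.1
      (hcompl.sup_eq_top ▸ Submodule.mem_top : x ∈ S ⊔ C)
    simp only [LinearMap.comp_apply, Submodule.mkQ_apply, Submodule.mapQ_apply, LinearMap.id_apply,
      LinearEquiv.coe_coe, map_add, hfix c hc]
    rw [add_left_inj, Submodule.Quotient.eq]
    exact S.sub_mem (hSst hs) hs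
  rw [hquot, LinearMap.det_id, mul_one]
  -- the isotropy algebra
  let T : Module.End ℂ V →ₗ[ℂ] Module.End ℂ V := h.conj.toLinearMap
  have hkst : 𝔨 ≤ 𝔨.comap T := fun X hX => hh X hX
  let 𝔨v : Submodule ℂ (Module.End ℂ V) := 𝔨 ⊓ LinearMap.ker (LinearMap.applyₗ v)
  have hkv : ∀ X, X ∈ 𝔨v ↔ X ∈ 𝔨 ∧ X v = 0 := fun X => Iff.rfl
  have hkvst : 𝔨v ≤ 𝔨v.comap T := by
    intro X hX
    rw [hkv] at hX
    refine (hkv _).2 ⟨hh X hX.1, ?_⟩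
    exact (hconj X).trans (by rw [hX.2, map_zero])
  have hkvadj : ∀ X ∈ 𝔨v, LinearMap.adjoint X ∈ 𝔨v := by
    intro X hX
    rw [hkv] at hX
    refine (hkv _).2 ⟨hadj X hX.1, ?_⟩
    -- As `X v = 0`, the relation `v ⟂ [X, X*] v` reads `‖X* v‖² = 0`.
    have h1 := hv _ (hbr X hX.1 _ (hadj X hX.1))
    rw [LinearMap.sub_apply, Module.End.mul_apply, Module.End.mul_apply, hX.2, map_zero, sub_zero,
      ← LinearMap.adjoint_inner_left] at h1
    exact inner_self_eq_zero.1 h1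
  have d1 := det_conj_restrict_eq 𝔨 hadj h hkst
  have d2 := det_conj_restrict_eq 𝔨v hkvadj h hkvst
  -- The orbit map `X ↦ X v` intertwines conjugation by `h` with `h`, because `h v = v`; its kernel
  -- on `𝔨` is `𝔨v`.
  have d3 := det_restrict_eq_mul T (h : V →ₗ[ℂ] V) (LinearMap.applyₗ v) hconj 𝔨 hkst hkvst hSst
  rcases d1 with d1 | d1 <;> rcases d2 with d2 | d2 <;> rw [d1, d2] at d3
  · left; linear_combination -d3
  · right; linear_combination d3
  · right; linear_combination -d3
  · left; linear_combination d3

end SelfAdjoint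

/-! ### Regular functions, and lifting invariants by complete reducibility. -/

section Regular

variable {n : ℕ} (G : Subgroup (GL (Fin n) ℂ))

/-- The algebra of regular functions on a subgroup of `GL_n(ℂ)`. -/
def regularFunctions : Subalgebra ℂ (G → ℂ) where
  carrier := {f | ∃ (p : MvPolynomial (Fin n × Fin n) ℂ) (k : ℕ), ∀ g : G,
    f g = MvPolynomial.eval (fun ij => (g : GL (Fin n) ℂ).1 ij.1 ij.2) p /
      (g : GL (Fin n) ℂ).1.det ^ k}
  mul_mem' := by
    rintro f f' ⟨p, k, h⟩ ⟨p', k', h'⟩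
    refine ⟨p * p', k + k', fun g => ?_⟩
    rw [Pi.mul_apply, h, h', map_mul, pow_add, div_mul_div_comm]
  add_mem' := by
    rintro f f' ⟨p, k, h⟩ ⟨p', k', h'⟩
    refine ⟨p * (Matrix.mvPolynomialX (Fin n) (Fin n) ℂ).det ^ k' +
      (Matrix.mvPolynomialX (Fin n) (Fin n) ℂ).det ^ k * p', k + k', fun g => ?_⟩
    have hdet : (g : GL (Fin n) ℂ).1.det ≠ 0 :=
      ((Matrix.isUnit_iff_isUnit_det _).1 (g : GL (Fin n) ℂ).isUnit).ne_zero
    have hX : MvPolynomial.eval (fun ij => (g : GL (Fin n) ℂ).1 ij.1 ij.2)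
        (Matrix.mvPolynomialX (Fin n) (Fin n) ℂ).det = (g : GL (Fin n) ℂ).1.det := by
      rw [Matrix.eval_det_mvPolynomialX]
      rfl
    rw [Pi.add_apply, h, h', map_add, map_mul, map_mul, map_pow, map_pow, hX, pow_add,
      div_add_div _ _ (pow_ne_zero _ hdet) (pow_ne_zero _ hdet)]
  algebraMap_mem' := fun c => ⟨MvPolynomial.C c, 0, fun g => by simp⟩

variable {G}

/-- Vectors which are invariant modulo a stable subspace lift to invariant vectors. -/
theorem IsReductive.exists_invariant_sub_mem (hG : IsReductive G) {W : Type*} [AddCommGroup W]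
    [Module ℂ W] (σ : Representation ℂ G W)
    (hσ : ∀ (l : Module.Dual ℂ W) (w : W), (fun g => l (σ g w)) ∈ regularFunctions G)
    (P : Submodule ℂ W) [FiniteDimensional ℂ P] (hP : ∀ g, P ≤ P.comap (σ g))
    (K : Submodule ℂ W) (hK : ∀ g, K ≤ K.comap (σ g)) (p : W) (hp : p ∈ P)
    (hpK : ∀ g, σ g p - p ∈ K) : ∃ p' : W, (∀ g, σ g p' = p') ∧ p - p' ∈ K := by
  -- `IsReductive` speaks only of representations on `Fin m → ℂ`, so `P` is transported there.
  let e : P ≃ₗ[ℂ] (Fin (Module.finrank ℂ P) → ℂ) := (Module.finBasis ℂ P).equivFun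
  let σ' : Representation ℂ G (Fin (Module.finrank ℂ P) → ℂ) :=
    { toFun := fun g => e.conj (σ.subrepresentation P hP g)
      map_one' := by
        rw [map_one]
        exact e.conj_id
      map_mul' := fun g h => by
        rw [map_mul]
        exact e.conj_comp _ _ }
  have hσ' : ∀ g x, σ' g x = e ((σ.subrepresentation P hP) g (e.symm x)) := fun g x => rfl
  have hrat : IsRational σ' := by
    intro l x
    obtain ⟨L, hL⟩ := LinearMap.exists_extend (l.comp (e : P →ₗ[ℂ] _))
    have := hσ L (e.symm x : P)
    refine (congrArg (· ∈ regularFunctions G) (funext fun g => ?_)).mp this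
    rw [hσ']
    exact LinearMap.congr_fun hL ((σ.subrepresentation P hP) g (e.symm x))
  obtain ⟨Q, hQ, hKQ⟩ := hG _ σ' hrat ((K.comap P.subtype).map (e : P →ₗ[ℂ] _)) (by
    rintro g _ ⟨x, hx, rfl⟩
    refine ⟨(σ.subrepresentation P hP) g x, hK g hx, ?_⟩
    simp [hσ'])
  obtain ⟨k, hk, q, hq, hkq⟩ := Submodule.mem_sup.1
    (hKQ.sup_eq_top ▸ Submodule.mem_top : e ⟨p, hp⟩ ∈ _)
  obtain ⟨x, hx, rfl⟩ := hk
  have hq' : q = e (⟨p, hp⟩ - x) := by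
    rw [map_sub, ← hkq]
    simp
  subst hq'
  refine ⟨p - x, fun g => ?_, by simpa using hx⟩
  -- The component of `p` in the invariant complement `Q` is fixed: its displacement by `g` lies
  -- both in `Q` and in the image of `K`.
  have h1 : σ' g (e (⟨p, hp⟩ - x)) - e (⟨p, hp⟩ - x) ∈ Q := Q.sub_mem (hQ g _ hq) hq
  have h2 : σ' g (e (⟨p, hp⟩ - x)) - e (⟨p, hp⟩ - x) ∈
      (K.comap P.subtype).map (e : P →ₗ[ℂ] _) := by
    refine ⟨(σ.subrepresentation P hP) g (⟨p, hp⟩ - x) - (⟨p, hp⟩ - x), ?_, ?_⟩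
    · change σ g (p - x) - (p - x) ∈ K
      rw [map_sub]
      have := K.sub_mem (hpK g) (K.sub_mem (hK g hx) hx)
      convert this using 1
      simp only [Submodule.subtype_apply]
      abel
    · rw [hσ', map_sub]
      simp
  have h3 := Submodule.disjoint_def.1 hKQ.disjoint _ h2 h1
  rw [hσ', LinearEquiv.symm_apply_apply, ← map_sub, LinearEquiv.map_eq_zero_iff] at h3
  exact sub_eq_zero.1 (congrArg Subtype.val h3)

end Regular

/-! ### Right translation of polynomial functions on matrices. -/

section Translation

open MvPolynomial

section Evaluation

variable {ι : Type*}

/-- Evaluation of a polynomial function on the space of square matrices. -/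
def evalMat (x : Matrix ι ι ℂ) : MvPolynomial (ι × ι) ℂ →ₐ[ℂ] ℂ :=
  aeval fun p => x p.1 p.2

@[simp]
theorem evalMat_X (x : Matrix ι ι ℂ) (p : ι × ι) : evalMat x (X p) = x p.1 p.2 := by
  simp [evalMat]

@[simp]
theorem evalMat_C (x : Matrix ι ι ℂ) (c : ℂ) : evalMat x (C c) = c := by
  simp [evalMat]

theorem evalMat_ext {p q : MvPolynomial (ι × ι) ℂ}
    (h : ∀ x : Matrix ι ι ℂ, evalMat x p = evalMat x q) :
    p = q := by
  refine MvPolynomial.funext fun y => ?_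
  have := h (Matrix.of fun i j => y (i, j))
  simpa [evalMat, aeval_eq_eval] using this

end Evaluation

variable {ι : Type*} [Fintype ι]

/-- Right translation of polynomial functions on matrices: `f ↦ (x ↦ f (x * m))`. -/
def rightTranslate (m : Matrix ι ι ℂ) : MvPolynomial (ι × ι) ℂ →ₐ[ℂ] MvPolynomial (ι × ι) ℂ :=
  aeval fun p => ∑ a, X (p.1, a) * C (m a p.2)

theorem rightTranslate_X (m : Matrix ι ι ℂ) (p : ι × ι) :
    rightTranslate m (X p) = ∑ a, X (p.1, a) * C (m a p.2) := by
  simp [rightTranslate]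

@[simp]
theorem rightTranslate_C (m : Matrix ι ι ℂ) (c : ℂ) :
    rightTranslate m (C c : MvPolynomial (ι × ι) ℂ) = C c := by
  simp [rightTranslate]

theorem evalMat_rightTranslate (x m : Matrix ι ι ℂ) (f : MvPolynomial (ι × ι) ℂ) :
    evalMat x (rightTranslate m f) = evalMat (x * m) f := by
  have : (evalMat x).comp (rightTranslate m) = evalMat (x * m) := by
    ext p
    simp [rightTranslate_X, Matrix.mul_apply]
  exact DFunLike.congr_fun this f

theorem rightTranslate_mul (m m' : Matrix ι ι ℂ) (f : MvPolynomial (ι × ι) ℂ) :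
    rightTranslate (m * m') f = rightTranslate m (rightTranslate m' f) :=
  evalMat_ext fun x => by simp only [evalMat_rightTranslate, Matrix.mul_assoc]

theorem rightTranslate_one [DecidableEq ι] (f : MvPolynomial (ι × ι) ℂ) :
    rightTranslate (1 : Matrix ι ι ℂ) f = f :=
  evalMat_ext fun x => by simp only [evalMat_rightTranslate, Matrix.mul_one]

theorem isHomogeneous_rightTranslate (m : Matrix ι ι ℂ) {f : MvPolynomial (ι × ι) ℂ} {d : ℕ}
    (hf : f.IsHomogeneous d) : (rightTranslate m f).IsHomogeneous d := by
  have := hf.aeval (fun p : ι × ι => ∑ a, X (p.1, a) * C (m a p.2)) (n := 1) (fun p =>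
    IsHomogeneous.sum _ _ _ fun a _ => by
      rw [mul_comm]
      exact isHomogeneous_C_mul_X _ _)
  rwa [one_mul] at this

theorem homogeneousComponent_rightTranslate (m : Matrix ι ι ℂ)
    (f : MvPolynomial (ι × ι) ℂ) (d : ℕ) :
    homogeneousComponent d (rightTranslate m f) = rightTranslate m (homogeneousComponent d f) := by
  conv_lhs => rw [← sum_homogeneousComponent f]
  rw [map_sum, map_sum]
  have h : ∀ i, homogeneousComponent d (rightTranslate m (homogeneousComponent i f)) =
      if d = i then rightTranslate m (homogeneousComponent i f) else 0 := fun i => by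
    rw [homogeneousComponent_of_mem (isHomogeneous_rightTranslate m
      (homogeneousComponent_isHomogeneous i f))]
  simp_rw [h]
  rw [Finset.sum_ite_eq]
  split_ifs with hd
  · rfl
  · rw [homogeneousComponent_eq_zero _ _ (by simpa using hd), map_zero]

theorem totalDegree_rightTranslate_le (m : Matrix ι ι ℂ) (f : MvPolynomial (ι × ι) ℂ) :
    (rightTranslate m f).totalDegree ≤ f.totalDegree := by
  conv_lhs => rw [← sum_homogeneousComponent f]
  rw [map_sum]
  refine (totalDegree_finsetSum _ _).trans (Finset.sup_le fun i hi => ?_)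
  refine (isHomogeneous_rightTranslate m
    (homogeneousComponent_isHomogeneous i f)).totalDegree_le.trans ?_
  exact Nat.lt_succ_iff.1 (Finset.mem_range.1 hi)

end Translation

/-! ### Invariant polynomials and averaging modulo stable subspaces. -/

section Invariants

open MvPolynomial

variable {n : ℕ} {G : Subgroup (GL (Fin n) ℂ)} {ι : Type*} [Fintype ι] [DecidableEq ι]

/-- Coefficients of `f (x * r g)` are polynomial in the entries of `r g`. This is the rationality
needed to apply reductivity to spaces of polynomials. -/
theorem rightTranslate_mem_regularFunctions {r : G →* Matrix ι ι ℂ}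
    (hr : ∀ i j, (fun g => r g i j) ∈ regularFunctions G) (f : MvPolynomial (ι × ι) ℂ)
    (l : Module.Dual ℂ (MvPolynomial (ι × ι) ℂ)) :
    (fun g => l (rightTranslate (r g) f)) ∈ regularFunctions G := by
  induction f using MvPolynomial.induction_on generalizing l with
  | C c =>
    simp only [rightTranslate_C]
    exact (regularFunctions G).algebraMap_mem (l (C c))
  | add p q hp hq =>
    simp only [map_add]
    exact add_mem (hp l) (hq l)
  | mul_X p s hp =>
    have : (fun g => l (rightTranslate (r g) (p * X s))) =
        ∑ a, (fun g => r g a s.2) *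
          fun g => (l.comp (LinearMap.mulRight ℂ (X (s.1, a)))) (rightTranslate (r g) p) := by
      funext g
      simp only [map_mul, rightTranslate_X, Finset.mul_sum, map_sum, Finset.sum_apply, Pi.mul_apply,
        LinearMap.comp_apply, LinearMap.mulRight_apply]
      refine Finset.sum_congr rfl fun a _ => ?_
      rw [← mul_assoc, mul_comm, C_mul', map_smul, smul_eq_mul]
    rw [this]
    exact sum_mem fun a _ => mul_mem (hr _ _) (hp _)

/-- The polynomial functions on matrices invariant under right translation by the image of `r`. -/
def matInvariants (r : G →* Matrix ι ι ℂ) : Subalgebra ℂ (MvPolynomial (ι × ι) ℂ) where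
  carrier := {f | ∀ g, rightTranslate (r g) f = f}
  mul_mem' := fun ha hb g => by rw [map_mul, ha g, hb g]
  add_mem' := fun ha hb g => by rw [map_add, ha g, hb g]
  algebraMap_mem' := fun c g => by simp

/-- Families of polynomials which are invariant modulo a stable subspace lift to families of
invariant polynomials. -/
theorem exists_matInvariants_sub_mem (hG : IsReductive G) {r : G →* Matrix ι ι ℂ}
    (hr : ∀ i j, (fun g => r g i j) ∈ regularFunctions G) {J : Type*} [Finite J]
    (K : Submodule ℂ (J → MvPolynomial (ι × ι) ℂ))
    (hK : ∀ (g : G), ∀ f ∈ K, (fun j => rightTranslate (r g) (f j)) ∈ K)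
    (f : J → MvPolynomial (ι × ι) ℂ)
    (hf : ∀ g : G, (fun j => rightTranslate (r g) (f j)) - f ∈ K) :
    ∃ f' : J → MvPolynomial (ι × ι) ℂ, (∀ j, f' j ∈ matInvariants r) ∧ f - f' ∈ K := by
  classical
  have := Fintype.ofFinite J
  let σ : Representation ℂ G (J → MvPolynomial (ι × ι) ℂ) :=
    { toFun := fun g => LinearMap.pi fun j => (rightTranslate (r g)).toLinearMap.comp
        (LinearMap.proj j)
      map_one' := by
        refine LinearMap.ext fun f => funext fun j => ?_
        simp [rightTranslate_one]
      map_mul' := fun g h => by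
        refine LinearMap.ext fun f => funext fun j => ?_
        simp [rightTranslate_mul] }
  have hσ : ∀ g f j, σ g f j = rightTranslate (r g) (f j) := fun _ _ _ => rfl
  -- Translation does not raise the degree, so bounding it by `D` gives a stable finite-dimensional
  -- space containing `f`.
  let D := Finset.univ.sup fun j => (f j).totalDegree
  let P : Submodule ℂ (J → MvPolynomial (ι × ι) ℂ) :=
    Submodule.pi Set.univ fun _ => restrictTotalDegree (ι × ι) ℂ D
  have hPmem : ∀ q, q ∈ P ↔ ∀ j, (q j).totalDegree ≤ D := fun q => by
    simp [P, Submodule.mem_pi, mem_restrictTotalDegree]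
  have : FiniteDimensional ℂ P := by
    let φ : P →ₗ[ℂ] (J → restrictTotalDegree (ι × ι) ℂ D) :=
      { toFun := fun q j => ⟨q.1 j, q.2 j trivial⟩
        map_add' := fun _ _ => rfl
        map_smul' := fun _ _ => rfl }
    refine FiniteDimensional.of_injective φ fun q q' h => Subtype.ext (funext fun j => ?_)
    exact congrArg Subtype.val (congrFun h j)
  have hreg : ∀ (l : Module.Dual ℂ (J → MvPolynomial (ι × ι) ℂ)) (w : J → MvPolynomial (ι × ι) ℂ),
      (fun g => l (σ g w)) ∈ regularFunctions G := by
    intro l w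
    have : (fun g => l (σ g w)) = ∑ j, fun g => (l.comp (LinearMap.single ℂ _ j))
        (rightTranslate (r g) (w j)) := by
      funext g
      rw [Finset.sum_apply]
      conv_lhs => rw [← Finset.univ_sum_single (σ g w), map_sum]
      rfl
    rw [this]
    exact sum_mem fun j _ => rightTranslate_mem_regularFunctions hr _ _
  have hPst : ∀ g, P ≤ P.comap (σ g) := by
    intro g q hq
    rw [Submodule.mem_comap, hPmem]
    rw [hPmem] at hq
    exact fun j => (totalDegree_rightTranslate_le _ _).trans (hq j)
  obtain ⟨f', h1, h2⟩ := hG.exists_invariant_sub_mem σ hreg P hPst K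
    (fun g q hq => hK g q hq) f ((hPmem f).2 fun j =>
      Finset.le_sup (f := fun j => (f j).totalDegree) (Finset.mem_univ j)) hf
  exact ⟨f', fun j g => congrFun (h1 g) j, h2⟩

/-- An invariant in the ideal generated by invariants is a combination of them with invariant
coefficients. -/
theorem exists_matInvariants_coeff (hG : IsReductive G) {r : G →* Matrix ι ι ℂ}
    (hr : ∀ i j, (fun g => r g i j) ∈ regularFunctions G) {J : Type*} [Fintype J]
    {f : J → MvPolynomial (ι × ι) ℂ} (hf : ∀ j, f j ∈ matInvariants r)
    {h : MvPolynomial (ι × ι) ℂ} (hh : h ∈ matInvariants r) (hspan : h ∈ Ideal.span (Set.range f)) :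
    ∃ a : J → MvPolynomial (ι × ι) ℂ, (∀ j, a j ∈ matInvariants r) ∧ ∑ j, a j * f j = h := by
  obtain ⟨a, ha⟩ := Ideal.mem_span_range_iff_exists_fun.1 hspan
  -- The kernel of `φ` is the space of syzygies of `f`. Translating the coefficients `a` leaves `φ a
  -- = h` unchanged, so `a` is invariant modulo `ker φ`.
  let φ : (J → MvPolynomial (ι × ι) ℂ) →ₗ[ℂ] MvPolynomial (ι × ι) ℂ :=
    ∑ j, (LinearMap.mulRight ℂ (f j)).comp (LinearMap.proj j)
  have hφ : ∀ q, φ q = ∑ j, q j * f j := fun q => by simp [φ]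
  have hφr : ∀ g q, φ (fun j => rightTranslate (r g) (q j)) = rightTranslate (r g) (φ q) := by
    intro g q
    rw [hφ, hφ, map_sum]
    exact Finset.sum_congr rfl fun j _ => by rw [map_mul, hf j g]
  obtain ⟨a', h1, h2⟩ := exists_matInvariants_sub_mem hG hr (LinearMap.ker φ)
    (fun g q hq => by rw [LinearMap.mem_ker] at *; rw [hφr, hq, map_zero]) a
    (fun g => by rw [LinearMap.mem_ker, map_sub, hφr, hφ, ha, hh g, sub_self])
  refine ⟨a', h1, ?_⟩
  rw [LinearMap.mem_ker, map_sub, sub_eq_zero, hφ, hφ, ha] at h2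
  exact h2.symm

end Invariants

/-! ### Finite generation of the invariants, closed images, and separation. -/

section Hilbert

open MvPolynomial

/-- Weak Nullstellensatz for ideals of functions on matrices. -/
theorem eq_top_of_forall_exists_evalMat_ne_zero {ι : Type*} [Finite ι]
    (I : Ideal (MvPolynomial (ι × ι) ℂ))
    (h : ∀ x : Matrix ι ι ℂ, ∃ f ∈ I, evalMat x f ≠ 0) : I = ⊤ := by
  by_contra hI
  obtain ⟨M, hM, hIM⟩ := Ideal.exists_le_maximal I hI
  obtain ⟨y, hy⟩ := eq_vanishingIdeal_singleton_of_isMaximal ℂ hM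
  obtain ⟨f, hf, hne⟩ := h (Matrix.of fun i j => y (i, j))
  have := hIM hf
  rw [hy, mem_vanishingIdeal_singleton_iff] at this
  exact hne this

variable {n : ℕ} {G : Subgroup (GL (Fin n) ℂ)} {ι : Type*} [Fintype ι] [DecidableEq ι]

theorem homogeneousComponent_mem_matInvariants {r : G →* Matrix ι ι ℂ} {f : MvPolynomial (ι × ι) ℂ}
    (hf : f ∈ matInvariants r) (d : ℕ) : homogeneousComponent d f ∈ matInvariants r := by
  intro g
  rw [← homogeneousComponent_rightTranslate, hf g]

theorem homogeneousComponent_mul_of_isHomogeneous {σ R : Type*} [CommSemiring R]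
    (a f : MvPolynomial σ R) {d e : ℕ} (hf : f.IsHomogeneous e) (hed : e ≤ d) :
    homogeneousComponent d (a * f) = homogeneousComponent (d - e) a * f := by
  conv_lhs => rw [← sum_homogeneousComponent a, Finset.sum_mul, map_sum]
  have h : ∀ i, homogeneousComponent d (homogeneousComponent i a * f) =
      if i = d - e then homogeneousComponent i a * f else 0 := fun i => by
    rw [homogeneousComponent_of_mem ((homogeneousComponent_isHomogeneous i a).mul hf)]
    congr 1
    simp only [eq_iff_iff]
    omega
  simp_rw [h]
  rw [Finset.sum_ite_eq']
  split_ifs with hd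
  · rfl
  · rw [homogeneousComponent_eq_zero _ _ (by simp at hd; omega), zero_mul]

/-- Hilbert's finiteness theorem. -/
theorem exists_finset_adjoin_eq_matInvariants (hG : IsReductive G) {r : G →* Matrix ι ι ℂ}
    (hr : ∀ i j, (fun g => r g i j) ∈ regularFunctions G) :
    ∃ T : Finset (MvPolynomial (ι × ι) ℂ), Algebra.adjoin ℂ (T : Set (MvPolynomial (ι × ι) ℂ)) =
      matInvariants r := by
  -- Positive degree makes the induction work: a coefficient of a generator of degree `e > 0` has
  -- degree `d - e < d`.
  let S : Set (MvPolynomial (ι × ι) ℂ) :=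
    {f | f ∈ matInvariants r ∧ ∃ d, 0 < d ∧ f.IsHomogeneous d}
  obtain ⟨T, hTS, hT⟩ := (Submodule.fg_span_iff_fg_span_finset_subset S).1
    (IsNoetherian.noetherian (Submodule.span (MvPolynomial (ι × ι) ℂ) S))
  refine ⟨T, le_antisymm (Algebra.adjoin_le fun f hf => (hTS hf).1) ?_⟩
  have key : ∀ d, ∀ h ∈ matInvariants r, h.IsHomogeneous d →
      h ∈ Algebra.adjoin ℂ (T : Set (MvPolynomial (ι × ι) ℂ)) := by
    intro d
    induction d using Nat.strong_induction_on with
    | _ d ih =>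
      intro h hh hhd
      rcases Nat.eq_zero_or_pos d with rfl | hd
      · rw [← homogeneousComponent_eq_self hhd, homogeneousComponent_zero]
        exact Subalgebra.algebraMap_mem _ _
      · have hspan : h ∈ Ideal.span (Set.range (Subtype.val : T → MvPolynomial (ι × ι) ℂ)) := by
          have h1 : h ∈ Submodule.span (MvPolynomial (ι × ι) ℂ) S :=
            Submodule.subset_span ⟨hh, d, hd, hhd⟩
          rw [hT] at h1
          simpa [Ideal.span] using h1
        obtain ⟨a, ha, hsum⟩ := exists_matInvariants_coeff hG hr
          (fun t : T => (hTS t.2).1) hh hspan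
        rw [← homogeneousComponent_eq_self hhd, ← hsum, map_sum]
        refine sum_mem fun t _ => ?_
        obtain ⟨e, he, hte⟩ := (hTS t.2).2
        by_cases hed : e ≤ d
        · rw [homogeneousComponent_mul_of_isHomogeneous _ _ hte hed]
          exact mul_mem (ih _ (by omega) _ (homogeneousComponent_mem_matInvariants (ha t) _)
            (homogeneousComponent_isHomogeneous _ _)) (Algebra.subset_adjoin t.2)
        · have : homogeneousComponent d (a t * t.1) = 0 := by
            rw [← sum_homogeneousComponent (a t), Finset.sum_mul, map_sum]
            refine Finset.sum_eq_zero fun i _ => ?_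
            rw [homogeneousComponent_of_mem ((homogeneousComponent_isHomogeneous i _).mul hte),
              if_neg (by omega)]
          rw [this]
          exact zero_mem _
  intro h hh
  rw [← sum_homogeneousComponent h]
  exact sum_mem fun i _ => key i _ (homogeneousComponent_mem_matInvariants hh i)
    (homogeneousComponent_isHomogeneous _ _)

theorem evalMat_det (x : Matrix ι ι ℂ) : evalMat x (mvPolynomialX ι ι ℂ).det = x.det := by
  rw [evalMat, aeval_eq_eval]
  exact eval_det_mvPolynomialX ι ℂ _

theorem rightTranslate_det (m : Matrix ι ι ℂ) :
    rightTranslate m (mvPolynomialX ι ι ℂ).det = C m.det * (mvPolynomialX ι ι ℂ).det :=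
  evalMat_ext fun x => by
    rw [evalMat_rightTranslate, map_mul, evalMat_det, evalMat_det, evalMat_C, det_mul, mul_comm]

theorem det_mem_matInvariants {r : G →* Matrix ι ι ℂ} (hdet : ∀ g, (r g).det = 1) :
    (mvPolynomialX ι ι ℂ).det ∈ matInvariants r := fun g => by
  rw [rightTranslate_det, hdet, C_1, one_mul]

/-- The matrices of determinant one have closed image under a generating family of invariants. -/
theorem isClosed_image_generators (hG : IsReductive G) {r : G →* Matrix ι ι ℂ}
    (hr : ∀ i j, (fun g => r g i j) ∈ regularFunctions G) (hdet : ∀ g, (r g).det = 1)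
    {J : Type*} [Fintype J] {f : J → MvPolynomial (ι × ι) ℂ}
    (hf : Algebra.adjoin ℂ (Set.range f) = matInvariants r) :
    IsClosed ((fun (m : Matrix ι ι ℂ) j => evalMat m (f j)) '' {m | m.det = 1}) := by
  refine isClosed_of_closure_subset fun y hy => ?_
  by_contra hne
  have hfA : ∀ j, f j ∈ matInvariants r := fun j => hf ▸ Algebra.subset_adjoin ⟨j, rfl⟩
  -- The common zeros of `F` are the matrices of determinant one mapping to `y`. If there are none,
  -- `F` generates the unit ideal.
  let F : Option J → MvPolynomial (ι × ι) ℂ := fun o =>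
    o.elim ((mvPolynomialX ι ι ℂ).det - C 1) fun j => f j - C (y j)
  have hCA : ∀ c, (C c : MvPolynomial (ι × ι) ℂ) ∈ matInvariants r := fun c =>
    (matInvariants r).algebraMap_mem c
  have hF : ∀ o, F o ∈ matInvariants r := by
    rintro (_ | j)
    · exact sub_mem (det_mem_matInvariants hdet) (hCA 1)
    · exact sub_mem (hfA j) (hCA _)
  have htop : Ideal.span (Set.range F) = ⊤ := by
    refine eq_top_of_forall_exists_evalMat_ne_zero _ fun x => ?_
    by_contra! hx
    refine hne ⟨x, ?_, funext fun j => ?_⟩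
    · have := hx _ (Ideal.subset_span ⟨none, rfl⟩)
      simpa [F, evalMat_det, sub_eq_zero] using this
    · have := hx _ (Ideal.subset_span ⟨some j, rfl⟩)
      simpa [F, sub_eq_zero] using this
  obtain ⟨a, ha, hsum⟩ := exists_matInvariants_coeff hG hr hF (one_mem (matInvariants r))
    (htop ▸ Submodule.mem_top)
  have hP : ∀ j, ∃ P : MvPolynomial J ℂ, aeval f P = a (some j) := fun j => by
    have := ha (some j)
    rw [← hf, Algebra.adjoin_range_eq_range_aeval] at this
    exact this
  choose P hP using hP
  -- This closed condition holds on the image, where the term of `det - 1` vanishes; at `y` it reads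
  -- `0 = 1`.
  have hclosed : IsClosed {z : J → ℂ | ∑ j, eval z (P j) * (z j - y j) = 1} :=
    isClosed_eq (continuous_finsetSum _ fun j _ => ((P j).continuous_eval).mul
      ((continuous_apply j).sub continuous_const)) continuous_const
  have hsub : (fun (m : Matrix ι ι ℂ) j => evalMat m (f j)) '' {m | m.det = 1} ⊆
      {z : J → ℂ | ∑ j, eval z (P j) * (z j - y j) = 1} := by
    rintro _ ⟨m, hm, rfl⟩
    have h1 := congrArg (evalMat m) hsum
    rw [map_sum, Fintype.sum_option, map_one] at h1
    have h0 : evalMat m (F none) = 0 := by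
      have hm : m.det = 1 := hm
      simp [F, evalMat_det, hm]
    rw [map_mul, h0, mul_zero, zero_add] at h1
    rw [Set.mem_ofPred_eq, ← h1]
    refine Finset.sum_congr rfl fun j _ => ?_
    rw [map_mul, ← hP j]
    congr 1
    · rw [← AlgHom.comp_apply, comp_aeval, aeval_eq_eval]
    · simp [F]
  have := hclosed.closure_subset_iff.2 hsub hy
  simp at this

/-- If the image of `r` is Zariski closed then the invariants separate it from other matrices. -/
theorem mem_range_of_forall_evalMat_eq (hG : IsReductive G) {r : G →* Matrix ι ι ℂ}
    (hr : ∀ i j, (fun g => r g i j) ∈ regularFunctions G)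
    (hdet : ∀ g, (r g).det = 1)
    (hclosed : ∀ x : Matrix ι ι ℂ, (∀ p, (∀ g, evalMat (r g) p = 0) → evalMat x p = 0) →
      x ∈ Set.range r) (m : Matrix ι ι ℂ)
    (hm : ∀ f ∈ matInvariants r, evalMat m f = evalMat 1 f) : m ∈ Set.range r := by
  by_contra hmr
  -- `I u` is the vanishing ideal of the coset `u * r(G)`. The cosets of `1` and `m` are closed and
  -- disjoint, so their ideals sum to the whole ring.
  let I : Matrix ι ι ℂ → Ideal (MvPolynomial (ι × ι) ℂ) := fun u =>
    ⨅ g : G, RingHom.ker (evalMat (u * r g))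
  have hI : ∀ u p, p ∈ I u ↔ ∀ g, evalMat (u * r g) p = 0 := fun u p => by
    simp [I, Submodule.mem_iInf, RingHom.mem_ker]
  have hIst : ∀ u g p, p ∈ I u → rightTranslate (r g) p ∈ I u := by
    intro u g p hp
    rw [hI] at *
    intro g'
    rw [evalMat_rightTranslate, mul_assoc, ← map_mul]
    exact hp _
  have hmdet : m.det = 1 := by
    simpa [evalMat_det] using hm _ (det_mem_matInvariants hdet)
  have hmm : m⁻¹ * m = 1 := Matrix.nonsing_inv_mul _ (by simp [hmdet])
  have hmm' : m * m⁻¹ = 1 := Matrix.mul_nonsing_inv _ (by simp [hmdet])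
  have htop : I 1 ⊔ I m = ⊤ := by
    refine eq_top_of_forall_exists_evalMat_ne_zero _ fun x => ?_
    by_contra! hx
    obtain ⟨g, rfl⟩ := hclosed x fun p hp => hx p (Ideal.mem_sup_left ((hI 1 p).2 fun g => by
      rw [one_mul]; exact hp g))
    obtain ⟨g', hg'⟩ := hclosed (m⁻¹ * r g) fun p hp => by
      let q : MvPolynomial (ι × ι) ℂ := aeval (fun s => ∑ a, C (m⁻¹ s.1 a) * X (a, s.2)) p
      have hq : ∀ z, evalMat z q = evalMat (m⁻¹ * z) p := fun z => by
        have : (evalMat z).comp (aeval fun s : ι × ι => ∑ a, C (m⁻¹ s.1 a) * X (a, s.2)) =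
            evalMat (m⁻¹ * z) := by
          ext s
          simp [Matrix.mul_apply]
        exact DFunLike.congr_fun this p
      rw [← hq]
      refine hx q (Ideal.mem_sup_right ((hI m q).2 fun g' => ?_))
      rw [hq, ← mul_assoc, hmm, one_mul]
      exact hp g'
    refine hmr ⟨g * g'⁻¹, ?_⟩
    have h1 : r g' * r g'⁻¹ = 1 := by rw [← map_mul, mul_inv_cancel, map_one]
    have h2 : r g = m * r g' := by rw [hg', ← mul_assoc, hmm', one_mul]
    rw [map_mul, h2, mul_assoc, h1, mul_one]
  obtain ⟨a, ha, b, hb, hab⟩ := Submodule.mem_sup.1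
    (htop ▸ Submodule.mem_top : (1 : MvPolynomial (ι × ι) ℂ) ∈ I 1 ⊔ I m)
  -- The polynomial `a` is `0` on one coset and `1` on the other, hence invariant modulo the
  -- intersection of the two ideals. An invariant lift keeps these values and separates `m` from
  -- `1`.
  let K : Submodule ℂ (Unit → MvPolynomial (ι × ι) ℂ) :=
    ((I 1 ⊓ I m).restrictScalars ℂ).comap (LinearMap.proj ())
  have hK : ∀ q, q ∈ K ↔ q () ∈ I 1 ∧ q () ∈ I m := fun q => Iff.rfl
  obtain ⟨a', ha', haa'⟩ := exists_matInvariants_sub_mem hG hr K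
    (fun g q hq => ⟨hIst _ _ _ hq.1, hIst _ _ _ hq.2⟩) (fun _ => a) (fun g => by
      refine (hK _).2 ⟨sub_mem (hIst _ _ _ ha) ha, ?_⟩
      have h1 : rightTranslate (r g) a - a = b - rightTranslate (r g) b := by
        have := congrArg (rightTranslate (r g)) hab
        rw [map_add, map_one, ← hab] at this
        linear_combination this
      simp only [Pi.sub_apply]
      rw [h1]
      exact sub_mem hb (hIst _ _ _ hb))
  rw [hK] at haa'
  have h1 : evalMat 1 (a' ()) = 0 := by
    have := (hI 1 _).1 (sub_mem ha haa'.1) 1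
    simpa using this
  have h2 : evalMat m (a' ()) = 1 := by
    have h3 := (hI m _).1 haa'.2 1
    have h4 := (hI m _).1 hb 1
    have h5 := congrArg (evalMat m) hab
    simp only [map_one, mul_one, Pi.sub_apply, map_sub, map_add] at h3 h4 h5
    linear_combination h5 - h4 - h3
  rw [hm _ (ha' ()), h1] at h2
  exact zero_ne_one h2

end Hilbert

/-! ### The infinitesimal right translations `lieDer A`. -/

section Derivation

open MvPolynomial

variable {ι : Type*} [Fintype ι]

/-- The derivation of the algebra of polynomial functions on matrices given by
`f ↦ (x ↦ df(x)(x * A))`. -/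
def lieDer (A : Matrix ι ι ℂ) : Derivation ℂ (MvPolynomial (ι × ι) ℂ) (MvPolynomial (ι × ι) ℂ) :=
  mkDerivation ℂ fun p => ∑ a, X (p.1, a) * C (A a p.2)

theorem lieDer_X (A : Matrix ι ι ℂ) (p : ι × ι) :
    lieDer A (X p) = ∑ a, X (p.1, a) * C (A a p.2) := by
  simp [lieDer]

theorem lieDer_add (A B : Matrix ι ι ℂ) : lieDer (A + B) = lieDer A + lieDer B := by
  refine derivation_ext fun p => ?_
  simp [lieDer_X, mul_add, Finset.sum_add_distrib]

theorem lieDer_smul (c : ℂ) (A : Matrix ι ι ℂ) : lieDer (c • A) = c • lieDer A := by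
  refine derivation_ext fun p => ?_
  simp only [lieDer_X, Derivation.smul_apply, Finset.smul_sum, Matrix.smul_apply, smul_eq_mul,
    smul_eq_C_mul, C_mul]
  exact Finset.sum_congr rfl fun a _ => by ring

/-- Stated only for coordinates: a composite of derivations is not a derivation. That is enough for
the commutator, which is one. -/
theorem lieDer_lieDer_X (A B : Matrix ι ι ℂ) (p : ι × ι) :
    lieDer A (lieDer B (X p)) = lieDer (A * B) (X p) := by
  simp only [lieDer_X, map_sum, mul_comm _ (C _), ← smul_eq_C_mul, Derivation.map_smul]
  simp only [Finset.smul_sum, smul_smul, Matrix.mul_apply, Finset.sum_smul]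
  rw [Finset.sum_comm]
  exact Finset.sum_congr rfl fun a _ => Finset.sum_congr rfl fun b _ => by rw [mul_comm]

theorem lieDer_commutator (A B : Matrix ι ι ℂ) (f : MvPolynomial (ι × ι) ℂ) :
    lieDer (A * B - B * A) f = lieDer A (lieDer B f) - lieDer B (lieDer A f) := by
  have : lieDer (A * B - B * A) = ⁅lieDer A, lieDer B⁆ := by
    refine derivation_ext fun p => ?_
    rw [Derivation.commutator_apply, lieDer_lieDer_X, lieDer_lieDer_X, sub_eq_add_neg,
      ← neg_one_smul ℂ, lieDer_add, lieDer_smul]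
    simp [sub_eq_add_neg]
  rw [this, Derivation.commutator_apply]

/-- Conjugation covariance. It serves twice: for `m` in the group, giving stability under `Ad`, and
for the minimising matrix. -/
theorem lieDer_rightTranslate {A B m : Matrix ι ι ℂ} (h : A * m = m * B)
    (f : MvPolynomial (ι × ι) ℂ) :
    lieDer A (rightTranslate m f) = rightTranslate m (lieDer B f) := by
  induction f using MvPolynomial.induction_on with
  | C c => simp [← algebraMap_eq]
  | add p q hp hq => simp only [map_add, hp, hq]
  | mul_X p s hp =>
    have hX : lieDer A (rightTranslate m (X s)) = rightTranslate m (lieDer B (X s)) := by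
      have h1 : ∀ b, ∑ a, A b a * m a s.2 = ∑ a, m b a * B a s.2 := fun b => by
        simpa [Matrix.mul_apply] using congrFun (congrFun h b) s.2
      simp only [lieDer_X, rightTranslate_X, map_sum, mul_comm _ (C _), ← smul_eq_C_mul,
        Derivation.map_smul, map_smul]
      simp only [Finset.smul_sum, smul_smul]
      rw [Finset.sum_comm]
      conv_rhs => rw [Finset.sum_comm]
      refine Finset.sum_congr rfl fun b _ => ?_
      rw [← Finset.sum_smul, ← Finset.sum_smul]
      congr 1
      rw [Finset.sum_congr rfl fun a _ => mul_comm (m a s.2) (A b a), h1]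
      exact Finset.sum_congr rfl fun a _ => mul_comm _ _
    simp only [map_mul, Derivation.leibniz, smul_eq_mul, map_add, hp, hX]

/-- The derivation `lieDer A` computes derivatives of right translates along a curve with
logarithmic derivative `A`. -/
theorem hasDerivAt_rightTranslate {A : Matrix ι ι ℂ} {γ : ℂ → Matrix ι ι ℂ} {t₀ : ℂ}
    (hγ : ∀ a b, HasDerivAt (fun t => γ t a b) ((γ t₀ * A) a b) t₀)
    (l : Module.Dual ℂ (MvPolynomial (ι × ι) ℂ)) (f : MvPolynomial (ι × ι) ℂ) :
    HasDerivAt (fun t => l (rightTranslate (γ t) f))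
      (l (rightTranslate (γ t₀) (lieDer A f))) t₀ := by
  induction f using MvPolynomial.induction_on generalizing l with
  | C c => simpa [← algebraMap_eq] using hasDerivAt_const t₀ (l (C c))
  | add p q hp hq =>
    simp only [map_add]
    exact (hp l).add (hq l)
  | mul_X p s hp =>
    have h1 : (fun t => l (rightTranslate (γ t) (p * X s))) = fun t => ∑ a, γ t a s.2 *
        (l.comp (LinearMap.mulRight ℂ (X (s.1, a)))) (rightTranslate (γ t) p) := by
      funext t
      simp only [map_mul, rightTranslate_X, Finset.mul_sum, map_sum,
        LinearMap.comp_apply, LinearMap.mulRight_apply]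
      refine Finset.sum_congr rfl fun a _ => ?_
      rw [← mul_assoc, mul_comm, C_mul', map_smul, smul_eq_mul]
    have h2 : l (rightTranslate (γ t₀) (lieDer A (p * X s))) = ∑ a, ((γ t₀ * A) a s.2 *
        (l.comp (LinearMap.mulRight ℂ (X (s.1, a)))) (rightTranslate (γ t₀) p) + γ t₀ a s.2 *
        (l.comp (LinearMap.mulRight ℂ (X (s.1, a)))) (rightTranslate (γ t₀) (lieDer A p))) := by
      have hX : rightTranslate (γ t₀) (lieDer A (X s)) =
          ∑ a, X (s.1, a) * C ((γ t₀ * A) a s.2) := by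
        simp only [lieDer_X, map_sum, map_mul, rightTranslate_X, rightTranslate_C, Matrix.mul_apply,
          Finset.mul_sum, Finset.sum_mul]
        rw [Finset.sum_comm]
        exact Finset.sum_congr rfl fun a _ => Finset.sum_congr rfl fun b _ => by ring
      rw [Derivation.leibniz, map_add, smul_eq_mul, smul_eq_mul, map_mul, map_mul, hX,
        rightTranslate_X, map_add, Finset.mul_sum, Finset.sum_mul, map_sum, map_sum,
        Finset.sum_add_distrib]
      congr 1 <;> refine Finset.sum_congr rfl fun a _ => ?_
      · rw [LinearMap.comp_apply, LinearMap.mulRight_apply, ← mul_assoc, mul_comm, C_mul',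
          map_smul, smul_eq_mul]
      · rw [LinearMap.comp_apply, LinearMap.mulRight_apply, mul_right_comm, mul_comm _ (C _),
          C_mul', map_smul, smul_eq_mul, mul_comm (X _)]
    rw [h1, h2]
    exact HasDerivAt.fun_sum fun a _ => (hγ a s.2).mul (hp _)

theorem exists_evalMat_eq_rightTranslate (f : MvPolynomial (ι × ι) ℂ)
    (l : Module.Dual ℂ (MvPolynomial (ι × ι) ℂ)) :
    ∃ c : MvPolynomial (ι × ι) ℂ, ∀ m, evalMat m c = l (rightTranslate m f) := by
  induction f using MvPolynomial.induction_on generalizing l with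
  | C c => exact ⟨C (l (C c)), fun m => by simp⟩
  | add p q hp hq =>
    obtain ⟨c, hc⟩ := hp l
    obtain ⟨d, hd⟩ := hq l
    exact ⟨c + d, fun m => by simp [hc, hd]⟩
  | mul_X p s hp =>
    choose c hc using fun a => hp (l.comp (LinearMap.mulRight ℂ (X (s.1, a))))
    refine ⟨∑ a, X (a, s.2) * c a, fun m => ?_⟩
    simp only [map_mul, rightTranslate_X, Finset.mul_sum, map_sum, hc,
      LinearMap.comp_apply, LinearMap.mulRight_apply, evalMat_X]
    refine Finset.sum_congr rfl fun a _ => ?_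
    rw [← mul_assoc, mul_comm _ (C _), C_mul', map_smul, smul_eq_mul]

/-- The determinant is multiplied by a scalar under every right translation, so it is an eigenvector
of every `lieDer A`. Consequently commutators kill it. -/
theorem exists_lieDer_det_eq [DecidableEq ι] (A : Matrix ι ι ℂ) :
    ∃ c : ℂ, lieDer A (mvPolynomialX ι ι ℂ).det = c • (mvPolynomialX ι ι ℂ).det := by
  let γ : ℂ → Matrix ι ι ℂ := fun t => 1 + t • A
  have hγ0 : γ 0 = 1 := by simp [γ]
  have hγ : ∀ a b, HasDerivAt (fun t => γ t a b) ((γ 0 * A) a b) 0 := fun a b => by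
    rw [hγ0, one_mul]
    simpa [γ] using ((hasDerivAt_id (0 : ℂ)).mul_const (A a b)).const_add ((1 : Matrix ι ι ℂ) a b)
  have h1 := hasDerivAt_rightTranslate hγ (evalMat 1).toLinearMap (mvPolynomialX ι ι ℂ).det
  refine ⟨(evalMat 1).toLinearMap (rightTranslate (γ 0) (lieDer A (mvPolynomialX ι ι ℂ).det)), ?_⟩
  ext α
  have h2 := hasDerivAt_rightTranslate hγ (lcoeff ℂ α) (mvPolynomialX ι ι ℂ).det
  simp only [rightTranslate_det, ← smul_eq_C_mul, map_smul, AlgHom.toLinearMap_apply, evalMat_det,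
    det_one, smul_eq_mul, mul_one] at h1 h2
  have h3 := h2.unique (h1.mul_const _)
  rw [hγ0, rightTranslate_one] at h3
  simpa [hγ0, rightTranslate_one] using h3

end Derivation

/-! ### The Fischer inner product on polynomials. -/

section Fischer

open MvPolynomial ComplexConjugate

variable {σ : Type*} [Fintype σ]

/-- The factorial of a multi-index. -/
def multiFactorial (α : σ →₀ ℕ) : ℕ := ∏ i, (α i).factorial

theorem multiFactorial_pos (α : σ →₀ ℕ) : 0 < multiFactorial α :=
  Finset.prod_pos fun _ _ => Nat.factorial_pos _

theorem multiFactorial_single_add (s : σ) (α : σ →₀ ℕ) :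
    multiFactorial (Finsupp.single s 1 + α) = multiFactorial α * (α s + 1) := by
  classical
  have h : ∀ i, ((Finsupp.single s 1 + α : σ →₀ ℕ) i).factorial =
      (α i).factorial * (if i = s then α s + 1 else 1) := by
    intro i
    by_cases hi : i = s
    · subst hi
      simp [Nat.add_comm 1, Nat.factorial_succ, mul_comm]
    · simp [hi]
  simp only [multiFactorial, h, Finset.prod_mul_distrib]
  simp

/-- The Fischer inner product on polynomials. -/
def fischer (p q : MvPolynomial σ ℂ) : ℂ :=
  ∑ α ∈ p.support, (multiFactorial α : ℂ) * (conj (coeff α p) * coeff α q)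

theorem fischer_eq_sum {p : MvPolynomial σ ℂ} {s : Finset (σ →₀ ℕ)} (hs : p.support ⊆ s)
    (q : MvPolynomial σ ℂ) :
    fischer p q = ∑ α ∈ s, (multiFactorial α : ℂ) * (conj (coeff α p) * coeff α q) := by
  refine Finset.sum_subset hs fun α _ hα => ?_
  rw [notMem_support_iff.1 hα, map_zero, zero_mul, mul_zero]

theorem fischer_add_left (p p' q : MvPolynomial σ ℂ) :
    fischer (p + p') q = fischer p q + fischer p' q := by
  classical
  rw [fischer_eq_sum (s := p.support ∪ p'.support) support_add,
    fischer_eq_sum (p := p) (s := p.support ∪ p'.support) Finset.subset_union_left,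
    fischer_eq_sum (p := p') (s := p.support ∪ p'.support) Finset.subset_union_right,
    ← Finset.sum_add_distrib]
  exact Finset.sum_congr rfl fun α _ => by rw [coeff_add, map_add]; ring

theorem fischer_conj_symm (p q : MvPolynomial σ ℂ) : conj (fischer p q) = fischer q p := by
  classical
  rw [fischer_eq_sum (p := p) (s := p.support ∪ q.support) Finset.subset_union_left,
    fischer_eq_sum (p := q) (s := p.support ∪ q.support) Finset.subset_union_right, map_sum]
  exact Finset.sum_congr rfl fun α _ => by
    rw [map_mul, map_mul, Complex.conj_conj, map_natCast, mul_comm (coeff α p)]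

theorem fischer_add_right (p q q' : MvPolynomial σ ℂ) :
    fischer p (q + q') = fischer p q + fischer p q' := by
  simp only [fischer, coeff_add, mul_add, Finset.sum_add_distrib]

theorem fischer_smul_right (c : ℂ) (p q : MvPolynomial σ ℂ) :
    fischer p (c • q) = c * fischer p q := by
  simp only [fischer, coeff_smul, Finset.mul_sum, smul_eq_mul]
  exact Finset.sum_congr rfl fun α _ => by ring

theorem fischer_zero_right (p : MvPolynomial σ ℂ) : fischer p 0 = 0 := by
  simp [fischer]

theorem fischer_sum_right {κ : Type*} (s : Finset κ) (p : MvPolynomial σ ℂ)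
    (q : κ → MvPolynomial σ ℂ) : fischer p (∑ k ∈ s, q k) = ∑ k ∈ s, fischer p (q k) := by
  classical
  induction s using Finset.induction_on with
  | empty => simp [fischer_zero_right]
  | insert a s ha ih => rw [Finset.sum_insert ha, Finset.sum_insert ha, fischer_add_right, ih]

theorem fischer_monomial_left (β : σ →₀ ℕ) (c : ℂ) (q : MvPolynomial σ ℂ) :
    fischer (monomial β c) q = (multiFactorial β : ℂ) * (conj c * coeff β q) := by
  classical
  rw [fischer_eq_sum (s := {β}) support_monomial_subset, Finset.sum_singleton, coeff_monomial,
    if_pos rfl]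

/-- The factorial weights are there for this: multiplication by a variable becomes adjoint to its
partial derivative. -/
theorem fischer_X_mul_left (s : σ) (p q : MvPolynomial σ ℂ) :
    fischer (X s * p) q = fischer p (pderiv s q) := by
  induction p using MvPolynomial.induction_on' with
  | add p p' hp hp' => rw [mul_add, fischer_add_left, fischer_add_left, hp, hp']
  | monomial β c =>
    rw [X, monomial_mul, one_mul, fischer_monomial_left, fischer_monomial_left, coeff_pderiv,
      multiFactorial_single_add, add_comm β]
    push_cast
    ring

theorem fischer_X_mul_right (s : σ) (p q : MvPolynomial σ ℂ) :
    fischer p (X s * q) = fischer (pderiv s p) q := by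
  rw [← fischer_conj_symm, fischer_X_mul_left, fischer_conj_symm]

theorem fischer_self {p : MvPolynomial σ ℂ} {s : Finset (σ →₀ ℕ)} (hs : p.support ⊆ s) :
    fischer p p = ((∑ α ∈ s, (multiFactorial α : ℝ) * ‖coeff α p‖ ^ 2 : ℝ) : ℂ) := by
  rw [fischer_eq_sum hs]
  push_cast
  refine Finset.sum_congr rfl fun α _ => ?_
  rw [Complex.conj_mul']

theorem fischer_self_re_nonneg (p : MvPolynomial σ ℂ) : 0 ≤ (fischer p p).re := by
  rw [fischer_self (Finset.Subset.refl _), Complex.ofReal_re]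
  positivity

theorem eq_zero_of_fischer_self_re_eq_zero {p : MvPolynomial σ ℂ} (h : (fischer p p).re = 0) :
    p = 0 := by
  rw [fischer_self (Finset.Subset.refl _), Complex.ofReal_re,
    Finset.sum_eq_zero_iff_of_nonneg (fun _ _ => by positivity)] at h
  by_contra hp
  obtain ⟨α, hα⟩ := support_nonempty.2 hp
  have h1 := h α hα
  have h2 := multiFactorial_pos α
  rw [mem_support_iff] at hα
  have : 0 < (multiFactorial α : ℝ) * ‖coeff α p‖ ^ 2 := by positivity
  exact this.ne' h1

end Fischer

/-! ### Adjoints of `lieDer` for the Fischer product. -/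

section Adjoint

open MvPolynomial ComplexConjugate

variable {ι : Type*} [Fintype ι]

theorem derivation_eq_sum {σ R : Type*} [Fintype σ] [CommSemiring R]
    (D : Derivation R (MvPolynomial σ R) (MvPolynomial σ R)) (f : MvPolynomial σ R) :
    D f = ∑ s, pderiv s f * D (X s) := by
  classical
  induction f using MvPolynomial.induction_on with
  | C c => simp [← algebraMap_eq]
  | add p q hp hq => simp only [map_add, hp, hq, add_mul, Finset.sum_add_distrib]
  | mul_X p t hp =>
    simp only [Derivation.leibniz, smul_eq_mul, add_mul, Finset.sum_add_distrib, pderiv_X]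
    congr 1
    · rw [Finset.sum_eq_single t]
      · simp
      · intro s _ hs
        simp [hs]
      · simp
    · rw [hp, Finset.mul_sum]
      exact Finset.sum_congr rfl fun s _ => (mul_assoc _ _ _).symm

theorem lieDer_eq_sum (A : Matrix ι ι ℂ) (f : MvPolynomial (ι × ι) ℂ) :
    lieDer A f = ∑ r, ∑ b, ∑ a, A a b • (X (r, a) * pderiv (r, b) f) := by
  rw [derivation_eq_sum, Fintype.sum_prod_type]
  refine Finset.sum_congr rfl fun r _ => Finset.sum_congr rfl fun b _ => ?_
  rw [lieDer_X, Finset.mul_sum]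
  refine Finset.sum_congr rfl fun a _ => ?_
  rw [smul_eq_C_mul]
  ring

/-- `lieDer A` is a combination of the operators `X (r, a) ∂(r, b)`, whose adjoints are `X (r, b)
∂(r, a)`; with conjugated scalars this transposes and conjugates `A`. -/
theorem fischer_lieDer_right (A : Matrix ι ι ℂ) (p q : MvPolynomial (ι × ι) ℂ) :
    fischer p (lieDer A q) = fischer (lieDer Aᴴ p) q := by
  rw [← fischer_conj_symm q]
  simp only [lieDer_eq_sum, fischer_sum_right, fischer_smul_right, fischer_X_mul_right, map_sum,
    map_mul, fischer_conj_symm, conjTranspose_apply, ← starRingEnd_apply, Complex.conj_conj]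
  refine Finset.sum_congr rfl fun r _ => ?_
  rw [Finset.sum_comm]

end Adjoint

/-! ### The Lie algebra as the annihilator of the invariants. -/

section Minimum

open MvPolynomial

variable {n : ℕ} {G : Subgroup (GL (Fin n) ℂ)} {ι : Type*} [Fintype ι] [DecidableEq ι]

theorem hasDerivAt_exp_smul_apply (A : Matrix ι ι ℂ) (t : ℂ) (i j : ι) :
    HasDerivAt (fun s : ℂ => (NormedSpace.exp (s • A) : Matrix ι ι ℂ) i j)
      ((NormedSpace.exp (t • A) * A) i j) t := by
  open scoped Matrix.Norms.Operator in
  exact (Matrix.entryLinearMap ℂ ℂ i j :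
    Matrix ι ι ℂ →ₗ[ℂ] ℂ).toContinuousLinearMap.hasFDerivAt.comp_hasDerivAt t
      (hasDerivAt_exp_smul_const A t)

/-- The Lie algebra of the group of matrices fixing the invariants of `r`. -/
def matLie (r : G →* Matrix ι ι ℂ) : Submodule ℂ (Matrix ι ι ℂ) where
  carrier := {A | ∀ f ∈ matInvariants r, lieDer A f = 0}
  zero_mem' := fun f _ => by
    have := lieDer_smul 0 (0 : Matrix ι ι ℂ)
    rw [zero_smul, zero_smul] at this
    rw [this, Derivation.zero_apply]
  add_mem' := fun ha hb f hf => by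
    rw [lieDer_add, Derivation.add_apply, ha f hf, hb f hf, add_zero]
  smul_mem' := fun c a ha f hf => by
    rw [lieDer_smul, Derivation.smul_apply, ha f hf, smul_zero]

theorem mem_matLie {r : G →* Matrix ι ι ℂ} {A : Matrix ι ι ℂ} :
    A ∈ matLie r ↔ ∀ f ∈ matInvariants r, lieDer A f = 0 := Iff.rfl

theorem commutator_mem_matLie {r : G →* Matrix ι ι ℂ} {A B : Matrix ι ι ℂ} (hA : A ∈ matLie r)
    (hB : B ∈ matLie r) : A * B - B * A ∈ matLie r := fun f hf => by
  rw [lieDer_commutator, hA f hf, hB f hf, map_zero, map_zero, sub_zero]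

theorem rightTranslate_exp_eq_of_lieDer_eq_zero {A : Matrix ι ι ℂ} {f : MvPolynomial (ι × ι) ℂ}
    (h : lieDer A f = 0) (t : ℂ) : rightTranslate (NormedSpace.exp (t • A)) f = f := by
  ext α
  have h1 : ∀ t, HasDerivAt (fun t : ℂ => lcoeff ℂ α (rightTranslate (NormedSpace.exp (t • A)) f))
      0 t := fun t => by
    have := hasDerivAt_rightTranslate (fun a b => hasDerivAt_exp_smul_apply A t a b) (lcoeff ℂ α) f
    rwa [h, map_zero, map_zero] at this
  have h2 := is_const_of_deriv_eq_zero (fun t => (h1 t).differentiableAt)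
    (fun t => (h1 t).deriv) t 0
  simpa [rightTranslate_one] using h2

/-- If `lieDer A` kills the invariants, they are constant along `exp (t A)`, and separation puts
this curve in the group. Conversely, differentiate the constant translate at `0`. -/
theorem mem_matLie_iff_exp (hG : IsReductive G) {r : G →* Matrix ι ι ℂ}
    (hr : ∀ i j, (fun g => r g i j) ∈ regularFunctions G) (hdet : ∀ g, (r g).det = 1)
    (hclosed : ∀ x : Matrix ι ι ℂ, (∀ p, (∀ g, evalMat (r g) p = 0) → evalMat x p = 0) →
      x ∈ Set.range r) (A : Matrix ι ι ℂ) :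
    A ∈ matLie r ↔ ∀ t : ℂ, NormedSpace.exp (t • A) ∈ Set.range r := by
  constructor
  · intro hA t
    refine mem_range_of_forall_evalMat_eq hG hr hdet hclosed _ fun f hf => ?_
    have := congrArg (evalMat 1) (rightTranslate_exp_eq_of_lieDer_eq_zero (hA f hf) t)
    rwa [evalMat_rightTranslate, one_mul] at this
  · intro h f hf
    ext α
    have h1 := hasDerivAt_rightTranslate (fun a b => hasDerivAt_exp_smul_apply A 0 a b)
      (lcoeff ℂ α) f
    have h2 : (fun t : ℂ => lcoeff ℂ α (rightTranslate (NormedSpace.exp (t • A)) f)) =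
        fun _ => lcoeff ℂ α f := funext fun t => by
      obtain ⟨g, hg⟩ := h t
      rw [← hg, hf g]
    rw [h2] at h1
    have := h1.unique (hasDerivAt_const _ _)
    simpa [rightTranslate_one] using this

end Minimum

/-! ### Minimising the Fischer norm of the generators. -/

section Minimum

open MvPolynomial ComplexConjugate

variable {n : ℕ} {G : Subgroup (GL (Fin n) ℂ)} {ι : Type*} [Fintype ι]

/-- One finite index set for all translates turns their Fischer norms into a fixed finite sum, to
which continuity and differentiation apply. -/
theorem exists_finset_support_subset {J : Type*} [Finite J] (f : J → MvPolynomial (ι × ι) ℂ) :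
    ∃ s : Finset (ι × ι →₀ ℕ), ∀ (m : Matrix ι ι ℂ) (j : J),
      (rightTranslate m (f j)).support ⊆ s := by
  have := Fintype.ofFinite J
  let D := Finset.univ.sup fun j => (f j).totalDegree
  refine ⟨(Finsupp.finite_of_degree_le (σ := ι × ι) D).toFinset, fun m j α hα => ?_⟩
  rw [Set.Finite.mem_toFinset]
  have h1 := le_totalDegree hα
  have h2 := totalDegree_rightTranslate_le m (f j)
  have h3 : (f j).totalDegree ≤ D :=
    Finset.le_sup (f := fun j => (f j).totalDegree) (Finset.mem_univ j)
  exact (h1.trans h2).trans h3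

variable [DecidableEq ι]

/-- A generating family of invariants has a right translate, by a matrix of determinant one, of
minimal Fischer norm. -/
theorem exists_isMin_fischer (hG : IsReductive G) {r : G →* Matrix ι ι ℂ}
    (hr : ∀ i j, (fun g => r g i j) ∈ regularFunctions G) (hdet : ∀ g, (r g).det = 1)
    {J : Type*} [Fintype J] {f : J → MvPolynomial (ι × ι) ℂ}
    (hf : Algebra.adjoin ℂ (Set.range f) = matInvariants r) :
    ∃ m : Matrix ι ι ℂ, m.det = 1 ∧ ∀ u : Matrix ι ι ℂ, u.det = 1 →
      ∑ j, (fischer (rightTranslate m (f j)) (rightTranslate m (f j))).re ≤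
        ∑ j, (fischer (rightTranslate u (f j)) (rightTranslate u (f j))).re := by
  obtain ⟨s, hs⟩ := exists_finset_support_subset f
  have hfA : ∀ j, f j ∈ matInvariants r := fun j => hf ▸ Algebra.subset_adjoin ⟨j, rfl⟩
  -- The coefficients of `x ↦ f j (x * m)` are polynomials in `m` that do not change under `m ↦ m *
  -- r g`. Being invariants, they are polynomials in the generators, so the norm depends only on the
  -- point `F m`.
  have hP : ∀ j α, ∃ P : MvPolynomial J ℂ, ∀ m : Matrix ι ι ℂ,
      eval (fun j => evalMat m (f j)) P = coeff α (rightTranslate m (f j)) := by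
    intro j α
    obtain ⟨c, hc⟩ := exists_evalMat_eq_rightTranslate (f j) (lcoeff ℂ α)
    have hcA : c ∈ matInvariants r := fun g => evalMat_ext fun x => by
      rw [evalMat_rightTranslate, hc, hc, rightTranslate_mul, hfA j g]
    rw [← hf, Algebra.adjoin_range_eq_range_aeval] at hcA
    obtain ⟨P, hPc⟩ := hcA
    have hPc : aeval f P = c := hPc
    refine ⟨P, fun m => ?_⟩
    rw [← lcoeff_apply, ← hc m, ← hPc, ← AlgHom.comp_apply, comp_aeval, aeval_eq_eval]
  choose P hP using hP
  let F : Matrix ι ι ℂ → J → ℂ := fun m j => evalMat m (f j)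
  let Ψ : (J → ℂ) → ℝ := fun y => ∑ j, ∑ α ∈ s, (multiFactorial α : ℝ) * ‖eval y (P j α)‖ ^ 2
  have hΨ : ∀ m, Ψ (F m) =
      ∑ j, (fischer (rightTranslate m (f j)) (rightTranslate m (f j))).re := by
    intro m
    refine Finset.sum_congr rfl fun j _ => ?_
    rw [fischer_self (hs m j), Complex.ofReal_re]
    exact Finset.sum_congr rfl fun α _ => by rw [hP]
  have hΨc : Continuous Ψ := continuous_finsetSum _ fun j _ => continuous_finsetSum _ fun α _ =>
    continuous_const.mul (((P j α).continuous_eval).norm.pow 2)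
  let κ : (ι × ι →₀ ℕ) → ℂ := fun α => evalMat 1 (monomial α 1)
  -- Evaluating the translate at `x = 1` recovers `f j m` from the coefficients. A bound on the norm
  -- thus bounds `F m`, which makes the sublevel set compact.
  have hval : ∀ m j, F m j = ∑ α ∈ s, eval (F m) (P j α) * κ α := by
    intro m j
    have h1 : F m j = evalMat 1 (rightTranslate m (f j)) := by
      rw [evalMat_rightTranslate, one_mul]
    rw [h1, as_sum (rightTranslate m (f j)), map_sum]
    rw [Finset.sum_subset (hs m j)]
    · refine Finset.sum_congr rfl fun α _ => ?_
      rw [hP, ← mul_one (coeff α (rightTranslate m (f j))), ← smul_eq_mul, ← smul_monomial,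
        map_smul, smul_eq_mul, smul_eq_mul, mul_one]
    · intro α _ hα
      rw [notMem_support_iff.1 hα, monomial_zero, map_zero]
  let c := Ψ (F 1)
  let B : ℝ := ∑ α ∈ s, Real.sqrt c * ‖κ α‖
  let Y : Set (J → ℂ) := F '' {m | m.det = 1} ∩ {y | Ψ y ≤ c}
  have hYclosed : IsClosed Y := (isClosed_image_generators hG hr hdet hf).inter
    (isClosed_le hΨc continuous_const)
  have hYsub : Y ⊆ Metric.closedBall 0 B := by
    rintro _ ⟨⟨m, -, rfl⟩, hm⟩
    have hB : 0 ≤ B := Finset.sum_nonneg fun _ _ => by positivity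
    rw [mem_closedBall_zero_iff, pi_norm_le_iff_of_nonneg hB]
    intro j
    rw [hval]
    refine (norm_sum_le _ _).trans (Finset.sum_le_sum fun α hα => ?_)
    rw [norm_mul]
    refine mul_le_mul_of_nonneg_right (Real.le_sqrt_of_sq_le ?_) (norm_nonneg _)
    refine le_trans ?_ hm
    calc ‖eval (F m) (P j α)‖ ^ 2 ≤ (multiFactorial α : ℝ) * ‖eval (F m) (P j α)‖ ^ 2 := by
          refine le_mul_of_one_le_left (by positivity) ?_
          exact_mod_cast multiFactorial_pos α
      _ ≤ ∑ α ∈ s, (multiFactorial α : ℝ) * ‖eval (F m) (P j α)‖ ^ 2 :=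
          Finset.single_le_sum (f := fun α => (multiFactorial α : ℝ) * ‖eval (F m) (P j α)‖ ^ 2)
            (fun _ _ => by positivity) hα
      _ ≤ Ψ (F m) := Finset.single_le_sum
            (f := fun j => ∑ α ∈ s, (multiFactorial α : ℝ) * ‖eval (F m) (P j α)‖ ^ 2)
            (fun _ _ => Finset.sum_nonneg fun _ _ => by positivity) (Finset.mem_univ j)
  have hYc : IsCompact Y := (isCompact_closedBall _ _).of_isClosed_subset hYclosed hYsub
  have h1Y : F 1 ∈ Y := ⟨⟨1, det_one, rfl⟩, le_refl c⟩
  obtain ⟨_, ⟨⟨m, hm, rfl⟩, hmc⟩, hmin⟩ := hYc.exists_isMinOn ⟨_, h1Y⟩ hΨc.continuousOn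
  refine ⟨m, hm, fun u hu => ?_⟩
  rw [← hΨ, ← hΨ]
  by_cases huc : Ψ (F u) ≤ c
  · exact hmin ⟨⟨u, hu, rfl⟩, huc⟩
  · exact hmc.trans (not_le.1 huc).le

/-- First order condition at a family of polynomials of minimal Fischer norm. -/
theorem sum_fischer_lieDer_eq_zero {J : Type*} [Fintype J] {f : J → MvPolynomial (ι × ι) ℂ}
    (hmin : ∀ u : Matrix ι ι ℂ, u.det = 1 → ∑ j, (fischer (f j) (f j)).re ≤
        ∑ j, (fischer (rightTranslate u (f j)) (rightTranslate u (f j))).re)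
    {A : Matrix ι ι ℂ} (hA : lieDer A (mvPolynomialX ι ι ℂ).det = 0) :
    ∑ j, fischer (f j) (lieDer A (f j)) = 0 := by
  obtain ⟨s, hs⟩ := exists_finset_support_subset f
  have hre : ∀ {A : Matrix ι ι ℂ}, lieDer A (mvPolynomialX ι ι ℂ).det = 0 →
      (∑ j, fischer (f j) (lieDer A (f j))).re = 0 := by
    intro A hA
    have hs1 : ∀ j, (f j).support ⊆ s := fun j => by
      have := hs 1 j
      rwa [rightTranslate_one] at this
    have hexp0 : NormedSpace.exp ((0 : ℂ) • A) = 1 := by simp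
    let φ : ℝ → ℝ := fun t => ∑ j, ∑ α ∈ s, (multiFactorial α : ℝ) *
      ‖coeff α (rightTranslate (NormedSpace.exp ((t : ℂ) • A)) (f j))‖ ^ 2
    have hφ : ∀ t, φ t = ∑ j, (fischer (rightTranslate (NormedSpace.exp ((t : ℂ) • A)) (f j))
        (rightTranslate (NormedSpace.exp ((t : ℂ) • A)) (f j))).re := fun t =>
      Finset.sum_congr rfl fun j _ => by rw [fischer_self (hs _ j), Complex.ofReal_re]
    -- Since `lieDer A` kills `det`, the curve stays among the competitors of the minimisation.
    have hdet : ∀ t : ℂ, (NormedSpace.exp (t • A)).det = 1 := fun t => by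
      have := congrArg (evalMat 1) (rightTranslate_exp_eq_of_lieDer_eq_zero hA t)
      rwa [evalMat_rightTranslate, evalMat_det, evalMat_det, one_mul, det_one] at this
    have hloc : IsLocalMin φ 0 := Filter.Eventually.of_forall fun t => by
      rw [hφ, hφ, Complex.ofReal_zero, hexp0]
      simp only [rightTranslate_one]
      exact hmin _ (hdet _)
    have hderiv : HasDerivAt φ (∑ j, ∑ α ∈ s, (multiFactorial α : ℝ) *
        (2 * inner ℝ (coeff α (f j)) (coeff α (lieDer A (f j))))) 0 := by
      refine HasDerivAt.fun_sum fun j _ => HasDerivAt.fun_sum fun α _ => HasDerivAt.const_mul _ ?_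
      have h1 := (hasDerivAt_rightTranslate (fun a b => hasDerivAt_exp_smul_apply A
        ((0 : ℝ) : ℂ) a b) (lcoeff ℂ α) (f j)).comp_ofReal
      have h2 := h1.norm_sq
      simpa [rightTranslate_one] using h2
    have h0 := hloc.hasDerivAt_eq_zero hderiv
    have h3 : ∑ j, ∑ α ∈ s, (multiFactorial α : ℝ) *
        (2 * inner ℝ (coeff α (f j)) (coeff α (lieDer A (f j)))) =
        2 * (∑ j, fischer (f j) (lieDer A (f j))).re := by
      rw [Complex.re_sum, Finset.mul_sum]
      refine Finset.sum_congr rfl fun j _ => ?_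
      rw [fischer_eq_sum (hs1 j), Complex.re_sum, Finset.mul_sum]
      refine Finset.sum_congr rfl fun α _ => ?_
      rw [← Complex.ofReal_natCast, Complex.re_ofReal_mul, Complex.inner, mul_comm (conj _)]
      ring
    linarith
  refine Complex.ext (hre hA) ?_
  -- Minimality controls only real parts; replacing `A` by `i A` handles the imaginary part.
  have h := hre (A := Complex.I • A) (by rw [lieDer_smul, Derivation.smul_apply, hA, smul_zero])
  simp only [lieDer_smul, Derivation.smul_apply, fischer_smul_right, ← Finset.mul_sum,
    Complex.I_mul_re] at h
  simpa using h

/-- Up to conjugation, the Lie algebra of a reductive group of matrices is closed under taking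
conjugate transposes. -/
theorem exists_conjTranspose_mem_matLie (hG : IsReductive G) {r : G →* Matrix ι ι ℂ}
    (hr : ∀ i j, (fun g => r g i j) ∈ regularFunctions G) (hdet : ∀ g, (r g).det = 1) :
    ∃ m : Matrix ι ι ℂ, m.det = 1 ∧ ∀ A ∈ matLie r, m⁻¹ * (m * A * m⁻¹)ᴴ * m ∈ matLie r := by
  obtain ⟨T, hT⟩ := exists_finset_adjoin_eq_matInvariants hG hr
  let f : T → MvPolynomial (ι × ι) ℂ := Subtype.val
  have hf : Algebra.adjoin ℂ (Set.range f) = matInvariants r := by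
    rw [← hT]
    simp [f]
  have hfA : ∀ j, f j ∈ matInvariants r := fun j => hf ▸ Algebra.subset_adjoin ⟨j, rfl⟩
  obtain ⟨m, hm, hmin⟩ := exists_isMin_fischer hG hr hdet hf
  have hmm : m⁻¹ * m = 1 := Matrix.nonsing_inv_mul _ (by simp [hm])
  have hmm' : m * m⁻¹ = 1 := Matrix.mul_nonsing_inv _ (by simp [hm])
  refine ⟨m, hm, fun A hA => ?_⟩
  let f' : T → MvPolynomial (ι × ι) ℂ := fun j => rightTranslate m (f j)
  have hmin' : ∀ u : Matrix ι ι ℂ, u.det = 1 → ∑ j, (fischer (f' j) (f' j)).re ≤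
      ∑ j, (fischer (rightTranslate u (f' j)) (rightTranslate u (f' j))).re := by
    intro u hu
    simp only [f', ← rightTranslate_mul]
    exact hmin _ (by rw [det_mul, hu, hm, one_mul])
  set B := m * A * m⁻¹ with hB
  have hBm : B * m = m * A := by rw [hB, mul_assoc, hmm, mul_one]
  have hBf : ∀ j, lieDer B (f' j) = 0 := fun j => by
    rw [lieDer_rightTranslate hBm, hA _ (hfA j), map_zero]
  have hcomm : lieDer (B * Bᴴ - Bᴴ * B) (mvPolynomialX ι ι ℂ).det = 0 := by
    obtain ⟨c, hc⟩ := exists_lieDer_det_eq B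
    obtain ⟨d, hd⟩ := exists_lieDer_det_eq Bᴴ
    rw [lieDer_commutator, hc, hd, Derivation.map_smul, Derivation.map_smul, hc, hd, smul_comm,
      sub_self]
  have hzero := sum_fischer_lieDer_eq_zero hmin' hcomm
  have hBH : ∀ j, lieDer Bᴴ (f' j) = 0 := by
    -- As `lieDer B` kills `f' j`, only `⟨f' j, lieDer B (lieDer Bᴴ (f' j))⟩` survives, a squared
    -- norm.
    have h1 : ∀ j, fischer (f' j) (lieDer (B * Bᴴ - Bᴴ * B) (f' j)) =
        fischer (lieDer Bᴴ (f' j)) (lieDer Bᴴ (f' j)) := fun j => by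
      rw [lieDer_commutator, hBf j, map_zero, sub_zero, fischer_lieDer_right]
    simp only [h1] at hzero
    have h2 := congrArg Complex.re hzero
    rw [Complex.re_sum, Complex.zero_re,
      Finset.sum_eq_zero_iff_of_nonneg fun j _ => fischer_self_re_nonneg _] at h2
    exact fun j => eq_zero_of_fischer_self_re_eq_zero (h2 j (Finset.mem_univ j))
  set D := m⁻¹ * Bᴴ * m with hD
  have hDm : Bᴴ * m = m * D := by rw [hD, ← mul_assoc, ← mul_assoc, hmm', one_mul]
  have hDf : ∀ j, lieDer D (f j) = 0 := fun j => by
    have h1 := hBH j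
    rw [lieDer_rightTranslate hDm] at h1
    have h2 := congrArg (rightTranslate m⁻¹) h1
    rwa [← rightTranslate_mul, hmm, rightTranslate_one, map_zero] at h2
  rw [mem_matLie]
  intro g hg
  rw [← hf] at hg
  induction hg using Algebra.adjoin_induction with
  | mem x hx =>
    obtain ⟨j, rfl⟩ := hx
    exact hDf j
  | algebraMap c => exact Derivation.map_algebraMap _ _
  | add x y _ _ hx hy => rw [map_add, hx, hy, add_zero]
  | mul x y _ _ hx hy => rw [Derivation.leibniz, hx, hy, smul_zero, smul_zero, add_zero]

end Minimum

/-! ### Zariski closed groups and closure properties of regular functions. -/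

section Closed

variable {n : ℕ} {G : Subgroup (GL (Fin n) ℂ)}

/-- Products of polynomials show that the sets `{p ≠ 0}` are stable under intersection, hence form a
basis; topological closedness then becomes a system of polynomial equations. -/
theorem mem_of_forall_eval_eq_zero (hG : @IsClosed _ (zariski n) (G : Set (GL (Fin n) ℂ)))
    (g : GL (Fin n) ℂ) (hg : ∀ p : MvPolynomial (Fin n × Fin n) ℂ,
      (∀ h : G, MvPolynomial.eval (fun ij => (h : GL (Fin n) ℂ).1 ij.1 ij.2) p = 0) →
        MvPolynomial.eval (fun ij => g.1 ij.1 ij.2) p = 0) : g ∈ G := by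
  let := zariski n
  by_contra hgG
  have hb := TopologicalSpace.isTopologicalBasis_of_subbasis_of_inter (α := GL (Fin n) ℂ) rfl (by
    rintro _ ⟨p, rfl⟩ _ ⟨q, rfl⟩
    refine ⟨p * q, ?_⟩
    ext x
    simp)
  obtain ⟨U, hU, hgU, hUG⟩ := hb.exists_subset_of_mem_open
    (show g ∈ (G : Set (GL (Fin n) ℂ))ᶜ from hgG) hG.isOpen_compl
  have hp : ∃ p : MvPolynomial (Fin n × Fin n) ℂ,
      U = {g : GL (Fin n) ℂ | MvPolynomial.eval (fun ij => g.1 ij.1 ij.2) p ≠ 0} := by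
    rcases hU with rfl | hU
    · exact ⟨1, by ext; simp⟩
    · exact hU
  obtain ⟨p, rfl⟩ := hp
  refine hgU (hg p fun h => ?_)
  by_contra hh
  exact hUG (show h.1 ∈ _ from hh) h.2

theorem det_ne_zero_of_mem (g : GL (Fin n) ℂ) : g.1.det ≠ 0 :=
  ((Matrix.isUnit_iff_isUnit_det _).1 g.isUnit).ne_zero

theorem det_mul_det_inv (g : GL (Fin n) ℂ) : g.1.det * (g⁻¹).1.det = 1 := by
  rw [← Matrix.det_mul, Units.mul_inv, Matrix.det_one]

theorem entry_mem_regularFunctions (i j : Fin n) :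
    (fun g : G => (g : GL (Fin n) ℂ).1 i j) ∈ regularFunctions G :=
  ⟨MvPolynomial.X (i, j), 0, fun g => by simp⟩

theorem det_mem_regularFunctions {κ : Type*} [Fintype κ] [DecidableEq κ] {M : G → Matrix κ κ ℂ}
    (hM : ∀ i j, (fun g => M g i j) ∈ regularFunctions G) :
    (fun g => (M g).det) ∈ regularFunctions G := by
  have : (fun g => (M g).det) = ∑ σ : Equiv.Perm κ, (Equiv.Perm.sign σ : ℤ) •
      ∏ i, fun g => M g (σ i) i := by
    funext g
    simp only [Matrix.det_apply, Finset.sum_apply, Pi.smul_apply, Finset.prod_apply]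
    rfl
  rw [this]
  exact sum_mem fun σ _ => zsmul_mem (prod_mem fun i _ => hM _ _) _

theorem inv_det_mem_regularFunctions :
    (fun g : G => ((g : GL (Fin n) ℂ).1.det)⁻¹) ∈ regularFunctions G :=
  ⟨1, 1, fun g => by simp⟩

/-- Cramer's rule: an entry of the inverse is a cofactor divided by the determinant. -/
theorem entry_inv_mem_regularFunctions (i j : Fin n) :
    (fun g : G => ((g⁻¹ : G) : GL (Fin n) ℂ).1 i j) ∈ regularFunctions G := by
  have h : (fun g : G => ((g⁻¹ : G) : GL (Fin n) ℂ).1 i j) =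
      (fun g : G => ((g : GL (Fin n) ℂ).1.det)⁻¹) *
        fun g : G => ((g : GL (Fin n) ℂ).1.updateRow j (Pi.single i 1)).det := by
    funext g
    have h1 : ((g⁻¹ : G) : GL (Fin n) ℂ).1 = ((g : GL (Fin n) ℂ).1)⁻¹ := by
      rw [InvMemClass.coe_inv]
      exact Matrix.coe_units_inv _
    rw [h1, Matrix.inv_def, Ring.inverse_eq_inv', Matrix.smul_apply, Matrix.adjugate_apply]
    rfl
  rw [h]
  refine mul_mem inv_det_mem_regularFunctions (det_mem_regularFunctions fun a b => ?_)
  by_cases ha : a = j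
  · subst ha
    simp only [Matrix.updateRow_self]
    exact (regularFunctions G).algebraMap_mem (Pi.single (M := fun _ => ℂ) i 1 b)
  · simp only [Matrix.updateRow_ne ha]
    exact entry_mem_regularFunctions a b

theorem eval_mem_regularFunctions {κ : Type*} {a : κ → G → ℂ} (ha : ∀ i, a i ∈ regularFunctions G)
    (p : MvPolynomial κ ℂ) :
    (fun g => MvPolynomial.eval (fun i => a i g) p) ∈ regularFunctions G := by
  induction p using MvPolynomial.induction_on with
  | C c =>
    simp only [MvPolynomial.eval_C]
    exact (regularFunctions G).algebraMap_mem c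
  | add p q hp hq =>
    simp only [map_add]
    exact add_mem hp hq
  | mul_X p s hp =>
    simp only [map_mul, MvPolynomial.eval_X]
    exact mul_mem hp (ha s)

theorem comp_inv_mem_regularFunctions {f : G → ℂ} (hf : f ∈ regularFunctions G) :
    (fun g => f g⁻¹) ∈ regularFunctions G := by
  obtain ⟨p, k, h⟩ := hf
  have h1 : (fun g => f g⁻¹) = (fun g : G =>
      MvPolynomial.eval (fun ij => ((g⁻¹ : G) : GL (Fin n) ℂ).1 ij.1 ij.2) p) *
        (fun g : G => (g : GL (Fin n) ℂ).1.det) ^ k := by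
    funext g
    have hd : (g : GL (Fin n) ℂ).1.det * ((g⁻¹ : G) : GL (Fin n) ℂ).1.det = 1 :=
      det_mul_det_inv (g : GL (Fin n) ℂ)
    rw [h, Pi.mul_apply, Pi.pow_apply, div_eq_iff (pow_ne_zero _ (det_ne_zero_of_mem _)),
      mul_assoc, ← mul_pow, hd, one_pow, mul_one]
  have h2 := eval_mem_regularFunctions (G := G) (κ := Fin n × Fin n)
    (a := fun ij g => ((g⁻¹ : G) : GL (Fin n) ℂ).1 ij.1 ij.2)
    (fun ij => entry_inv_mem_regularFunctions ij.1 ij.2) p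
  have h3 := det_mem_regularFunctions (G := G) (M := fun g => (g : GL (Fin n) ℂ).1)
    entry_mem_regularFunctions
  rw [h1]
  exact mul_mem h2 (pow_mem h3 k)

end Closed

/-! ### Realizing `G` and `ρ` in a closed matrix group of determinant one. -/

section Model

variable {n : ℕ} {G : Subgroup (GL (Fin n) ℂ)} {V : Type*} [AddCommGroup V] [Module ℂ V]

/-- A realization of a rational representation inside a Zariski closed group of matrices of
determinant one, isomorphic to `G`. -/
structure MatrixModel (ρ : Representation ℂ G V) (ι : Type*) [Fintype ι] [DecidableEq ι] where
  /-- the isomorphism onto a matrix group -/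
  r : G →* Matrix ι ι ℂ
  regular : ∀ i j, (fun g => r g i j) ∈ regularFunctions G
  det_eq_one : ∀ g, (r g).det = 1
  closed : ∀ x : Matrix ι ι ℂ, (∀ p, (∀ g, evalMat (r g) p = 0) → evalMat x p = 0) →
    x ∈ Set.range r
  /-- the position of the standard representation -/
  idx : Fin n → ι
  r_idx : ∀ g i j, r g (idx i) (idx j) = (g : GL (Fin n) ℂ).1 i j
  /-- the inclusion of `V` -/
  incl : V →ₗ[ℂ] (ι → ℂ)
  /-- a projection to `V` -/
  proj : (ι → ℂ) →ₗ[ℂ] V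
  proj_incl : ∀ x, proj (incl x) = x
  r_incl : ∀ g x, r g *ᵥ incl x = incl (ρ g x)

theorem det_rep_mem_regularFunctions [FiniteDimensional ℂ V] {ρ : Representation ℂ G V}
    (hρ : IsRational ρ) : (fun g => LinearMap.det (ρ g)) ∈ regularFunctions G := by
  classical
  let b := Module.finBasis ℂ V
  have : (fun g => LinearMap.det (ρ g)) = fun g => (LinearMap.toMatrix b b (ρ g)).det := by
    funext g
    rw [LinearMap.det_toMatrix]
  rw [this]
  refine det_mem_regularFunctions fun i j => ?_
  simp only [LinearMap.toMatrix_apply]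
  exact hρ (b.coord i) (b j)

theorem det_rep_mul_det_rep_inv (ρ : Representation ℂ G V) (g : G) :
    LinearMap.det (ρ g) * LinearMap.det (ρ g⁻¹) = 1 := by
  rw [← map_mul, ← map_mul, mul_inv_cancel, map_one, map_one]

/-- The block diagonal representation `g ↦ diag (g, ρ g, (det g * det (ρ g))⁻¹)`. -/
def blockRep {κ : Type*} [Fintype κ] [DecidableEq κ] (ρ : Representation ℂ G V)
    (b : Module.Basis κ ℂ V) : G →* Matrix (Fin n ⊕ (κ ⊕ Unit)) (Fin n ⊕ (κ ⊕ Unit)) ℂ where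
  toFun g := fromBlocks (g : GL (Fin n) ℂ).1 0 0 (fromBlocks (LinearMap.toMatrix b b (ρ g)) 0 0
    (Matrix.of fun _ _ => (((g : GL (Fin n) ℂ).1.det)⁻¹ * LinearMap.det (ρ g⁻¹))))
  map_one' := by
    have : (Matrix.of fun _ _ => (1 : ℂ)) = (1 : Matrix Unit Unit ℂ) := by ext; simp
    simp [LinearMap.toMatrix_one, this]
  map_mul' g h := by
    simp only [fromBlocks_multiply, map_mul, LinearMap.toMatrix_mul, _root_.mul_inv_rev,
      Subgroup.coe_mul, Units.val_mul, det_mul]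
    simp only [Matrix.mul_zero, Matrix.zero_mul, add_zero, zero_add]
    congr 2
    ext i j
    simp [Matrix.mul_apply]
    ring

/-- The first block is faithful and the last normalizes the determinant. The image is closed because
it is cut out by the equations of `G`, the graph equations of `ρ`, the vanishing of the off-diagonal
blocks and `det = 1`. -/
theorem exists_matrixModel [FiniteDimensional ℂ V]
    (hG : @IsClosed _ (zariski n) (G : Set (GL (Fin n) ℂ))) {ρ : Representation ℂ G V}
    (hρ : IsRational ρ) :
    Nonempty (MatrixModel ρ (Fin n ⊕ (Fin (Module.finrank ℂ V) ⊕ Unit))) := by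
  let b := Module.finBasis ℂ V
  let κ := Fin (Module.finrank ℂ V)
  let ι := Fin n ⊕ (κ ⊕ Unit)
  let r := blockRep ρ b
  have hr : ∀ g, r g = fromBlocks (g : GL (Fin n) ℂ).1 0 0 (fromBlocks
    (LinearMap.toMatrix b b (ρ g)) 0 0
    (Matrix.of fun _ _ => (((g : GL (Fin n) ℂ).1.det)⁻¹ * LinearMap.det (ρ g⁻¹)))) := fun g => rfl
  have hdet : ∀ g, (r g).det = 1 := fun g => by
    rw [hr, det_fromBlocks_zero₂₁, det_fromBlocks_zero₂₁, det_unique (n := Unit),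
      LinearMap.det_toMatrix, Matrix.of_apply]
    have h1 := det_rep_mul_det_rep_inv ρ g
    have h2 := mul_inv_cancel₀ (det_ne_zero_of_mem (g : GL (Fin n) ℂ))
    linear_combination h1 + (LinearMap.det (ρ g) * LinearMap.det (ρ g⁻¹)) * h2
  refine ⟨⟨r, ?_, hdet, ?_, Sum.inl, fun g i j => rfl,
    { toFun := fun x => Sum.elim 0 (Sum.elim (b.equivFun x) 0)
      map_add' := fun x y => by ext (i | i | i) <;> simp
      map_smul' := fun c x => by ext (i | i | i) <;> simp },
    (b.equivFun.symm : (κ → ℂ) →ₗ[ℂ] V).comp (LinearMap.funLeft ℂ ℂ fun i => Sum.inr (Sum.inl i)),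
    fun x => ?_, fun g x => ?_⟩⟩
  · have h0 : (fun _ : G => (0 : ℂ)) ∈ regularFunctions G := zero_mem _
    rintro (i | i | i) (j | j | j)
    · exact entry_mem_regularFunctions i j
    · exact h0
    · exact h0
    · exact h0
    · have : (fun g => r g (Sum.inr (Sum.inl i)) (Sum.inr (Sum.inl j))) =
          fun g => b.coord i (ρ g (b j)) := by
        funext g
        rw [hr, fromBlocks_apply₂₂, fromBlocks_apply₁₁, LinearMap.toMatrix_apply]
        rfl
      rw [this]
      exact hρ _ _
    · exact h0
    · exact h0
    · exact h0
    · exact mul_mem inv_det_mem_regularFunctions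
        (comp_inv_mem_regularFunctions (det_rep_mem_regularFunctions hρ))
  · intro x hx
    have hX : ∀ i j, (∀ g, r g i j = 0) → x i j = 0 := fun i j h => by
      simpa using hx (MvPolynomial.X (i, j)) (by simpa using h)
    let a : Matrix (Fin n) (Fin n) ℂ := x.toBlocks₁₁
    let c : Matrix κ κ ℂ := x.toBlocks₂₂.toBlocks₁₁
    let s : Matrix Unit Unit ℂ := x.toBlocks₂₂.toBlocks₂₂
    have hxb : x = fromBlocks a 0 0 (fromBlocks c 0 0 s) := by
      ext (i | i | i) (j | j | j)
      · rfl
      · exact hX _ _ fun g => rfl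
      · exact hX _ _ fun g => rfl
      · exact hX _ _ fun g => rfl
      · rfl
      · exact hX _ _ fun g => rfl
      · exact hX _ _ fun g => rfl
      · exact hX _ _ fun g => rfl
      · rfl
    have hdx : a.det * (c.det * s.det) = 1 := by
      have := hx ((mvPolynomialX ι ι ℂ).det - MvPolynomial.C 1) fun g => by
        rw [map_sub, evalMat_det, hdet, evalMat_C, sub_self]
      rw [map_sub, evalMat_det, evalMat_C, sub_eq_zero, hxb, det_fromBlocks_zero₂₁,
        det_fromBlocks_zero₂₁] at this
      exact this
    have ha : a.det ≠ 0 := left_ne_zero_of_mul_eq_one hdx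
    let j : MvPolynomial (Fin n × Fin n) ℂ →ₐ[ℂ] MvPolynomial (ι × ι) ℂ :=
      MvPolynomial.rename (Prod.map Sum.inl Sum.inl)
    have hj : ∀ (y : Matrix ι ι ℂ) p, evalMat y (j p) =
        MvPolynomial.eval (fun ij => y (Sum.inl ij.1) (Sum.inl ij.2)) p := fun y p => by
      rw [evalMat, MvPolynomial.aeval_rename, MvPolynomial.aeval_eq_eval]
      rfl
    let g₀ : GL (Fin n) ℂ := Matrix.GeneralLinearGroup.mkOfDetNeZero a ha
    have hg₀ : g₀ ∈ G := mem_of_forall_eval_eq_zero hG g₀ fun p hp => by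
      have := hx (j p) fun g => (hj _ _).trans (hp g)
      rwa [hj] at this
    let g : G := ⟨g₀, hg₀⟩
    have hc : LinearMap.toMatrix b b (ρ g) = c := by
      ext i k
      obtain ⟨p, d, hp⟩ := hρ (b.coord i) (b k)
      have hp' : ∀ g, LinearMap.toMatrix b b (ρ g) i k = MvPolynomial.eval
          (fun ij => (g : GL (Fin n) ℂ).1 ij.1 ij.2) p / (g : GL (Fin n) ℂ).1.det ^ d := fun g => by
        rw [← hp, LinearMap.toMatrix_apply]
        rfl
      -- The graph equation of the coefficient `p / det ^ d`, with its denominator cleared.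
      have := hx (j p - j (mvPolynomialX (Fin n) (Fin n) ℂ).det ^ d *
          MvPolynomial.X (Sum.inr (Sum.inl i), Sum.inr (Sum.inl k))) fun g => by
        rw [map_sub, map_mul, map_pow, hj, hj, evalMat_X, eval_det_mvPolynomialX]
        change MvPolynomial.eval (fun ij => (g : GL (Fin n) ℂ).1 ij.1 ij.2) p -
          (g : GL (Fin n) ℂ).1.det ^ d * LinearMap.toMatrix b b (ρ g) i k = 0
        rw [hp', mul_div_cancel₀ _ (pow_ne_zero _ (det_ne_zero_of_mem _)), sub_self]
      rw [map_sub, map_mul, map_pow, hj, hj, evalMat_X, eval_det_mvPolynomialX] at this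
      rw [hp', div_eq_iff (pow_ne_zero _ (det_ne_zero_of_mem _)), mul_comm]
      exact sub_eq_zero.1 this
    refine ⟨g, ?_⟩
    rw [hr, hc, hxb]
    congr 2
    ext u v
    have h1 := det_rep_mul_det_rep_inv ρ g
    rw [← LinearMap.det_toMatrix b, hc] at h1
    have hcd : c.det ≠ 0 := left_ne_zero_of_mul_eq_one h1
    rw [det_unique s] at hdx
    have hs : s u v = s default default := rfl
    have hga : (g : GL (Fin n) ℂ).1 = a := rfl
    rw [hs, Matrix.of_apply, hga, ← mul_right_inj' ha, ← mul_right_inj' hcd,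
      mul_inv_cancel_left₀ ha, h1, ← hdx]
    ring
  · simp only [LinearMap.comp_apply, LinearMap.coe_mk, AddHom.coe_mk]
    rw [LinearEquiv.coe_coe, LinearEquiv.symm_apply_eq]
    rfl
  · rw [hr]
    simp only [LinearMap.coe_mk, AddHom.coe_mk, fromBlocks_mulVec]
    ext (i | i | i)
    · simp
    · simp [← LinearMap.toMatrix_mulVec_repr b b (ρ g)]
    · simp

end Model

/-! ### One-parameter groups of matrices. -/

section OneParameter

variable {ι : Type*} [Fintype ι] [DecidableEq ι]

theorem exp_add_smul (A : Matrix ι ι ℂ) (s t : ℂ) :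
    NormedSpace.exp ((s + t) • A) = NormedSpace.exp (s • A) * NormedSpace.exp (t • A) := by
  rw [add_smul, Matrix.exp_add_of_commute _ _ (((Commute.refl A).smul_left s).smul_right t)]

/-- A differentiable one-parameter group of matrices is given by the exponential. -/
theorem eq_exp_of_hasDerivAt {φ : ℂ → Matrix ι ι ℂ} {A : Matrix ι ι ℂ} (h0 : φ 0 = 1)
    (hadd : ∀ s t, φ (s + t) = φ s * φ t)
    (hφ : ∀ i j, HasDerivAt (fun t => φ t i j) (A i j) 0) (t : ℂ) :
    φ t = NormedSpace.exp (t • A) := by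
  have hder : ∀ t i j, HasDerivAt (fun t => φ t i j) ((φ t * A) i j) t := by
    intro t i j
    have h1 : HasDerivAt (fun s => φ (t + s) i j) ((φ t * A) i j) 0 := by
      simp only [hadd, Matrix.mul_apply]
      exact HasDerivAt.fun_sum fun k _ => (hφ k j).const_mul _
    have h2 := HasDerivAt.comp_sub_const (a := t) (x := t) (f := fun s => φ (t + s) i j)
      (by rwa [sub_self])
    simpa using h2
  have hcomm : ∀ t : ℂ, A * NormedSpace.exp (t • -A) = NormedSpace.exp (t • -A) * A := fun t =>
    (((Commute.refl A).neg_right.smul_right t).exp_right).eq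
  -- The product has zero derivative, since `φ' = φ A` and `A` commutes with its exponentials.
  have hconst : ∀ i j t, (φ t * NormedSpace.exp (t • -A)) i j = (1 : Matrix ι ι ℂ) i j := by
    intro i j t
    have hd : ∀ t, HasDerivAt (fun t => (φ t * NormedSpace.exp (t • -A)) i j) 0 t := by
      intro t
      have h1 : HasDerivAt (fun t => ∑ k, φ t i k * NormedSpace.exp (t • -A) k j)
          (∑ k, ((φ t * A) i k * NormedSpace.exp (t • -A) k j +
            φ t i k * (NormedSpace.exp (t • -A) * -A) k j)) t :=
        HasDerivAt.fun_sum fun k _ => (hder t i k).mul (hasDerivAt_exp_smul_apply (-A) t k j)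
      have h2 : ∑ k, ((φ t * A) i k * NormedSpace.exp (t • -A) k j +
          φ t i k * (NormedSpace.exp (t • -A) * -A) k j) = 0 := by
        rw [Finset.sum_add_distrib, ← Matrix.mul_apply, ← Matrix.mul_apply, Matrix.mul_assoc, hcomm,
          Matrix.mul_neg, Matrix.mul_neg, Matrix.neg_apply, add_neg_cancel]
      rw [h2] at h1
      simpa only [Matrix.mul_apply] using h1
    have := is_const_of_deriv_eq_zero (fun t => (hd t).differentiableAt) (fun t => (hd t).deriv) t 0
    simpa [h0] using this
  have h1 : φ t * NormedSpace.exp (t • -A) = 1 := by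
    ext i j
    exact hconst i j t
  have h2 : NormedSpace.exp (t • -A) * NormedSpace.exp (t • A) = 1 := by
    rw [smul_neg, ← neg_smul, ← exp_add_smul]
    simp
  calc φ t = φ t * (NormedSpace.exp (t • -A) * NormedSpace.exp (t • A)) := by rw [h2, mul_one]
    _ = NormedSpace.exp (t • A) := by rw [← mul_assoc, h1, one_mul]

theorem hasDerivAt_dual_mulVec {φ : ℂ → Matrix ι ι ℂ} {A : Matrix ι ι ℂ}
    (hφ : ∀ i j, HasDerivAt (fun t => φ t i j) (A i j) 0) (L : Module.Dual ℂ (ι → ℂ)) (z : ι → ℂ) :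
    HasDerivAt (fun t => L (φ t *ᵥ z)) (L (A *ᵥ z)) 0 := by
  have h : ∀ B : Matrix ι ι ℂ, L (B *ᵥ z) = ∑ i, (∑ j, B i j * z j) * L (Pi.single i 1) := by
    intro B
    conv_lhs => rw [pi_eq_sum_univ' (B *ᵥ z)]
    rw [map_sum]
    exact Finset.sum_congr rfl fun i _ => by rw [map_smul, smul_eq_mul]; rfl
  simp only [h]
  exact HasDerivAt.fun_sum fun i _ =>
    (HasDerivAt.fun_sum fun j _ => (hφ i j).mul_const _).mul_const _

theorem hasDerivAt_exp_zero_apply (A : Matrix ι ι ℂ) (i j : ι) :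
    HasDerivAt (fun t : ℂ => (NormedSpace.exp (t • A) : Matrix ι ι ℂ) i j) (A i j) 0 := by
  have := hasDerivAt_exp_smul_apply A 0 i j
  simpa using this

theorem differentiableAt_regularFunction {n : ℕ} {G : Subgroup (GL (Fin n) ℂ)} {f : G → ℂ}
    (hf : f ∈ regularFunctions G) {γ : ℂ → G} {t : ℂ}
    (hγ : ∀ i j, DifferentiableAt ℂ (fun t => (γ t : GL (Fin n) ℂ).1 i j) t) :
    DifferentiableAt ℂ (fun t => f (γ t)) t := by
  obtain ⟨p, k, h⟩ := hf
  have hpoly : ∀ p : MvPolynomial (Fin n × Fin n) ℂ, DifferentiableAt ℂ (fun t =>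
      MvPolynomial.eval (fun ij => (γ t : GL (Fin n) ℂ).1 ij.1 ij.2) p) t := by
    intro p
    induction p using MvPolynomial.induction_on with
    | C c => simp
    | add p q hp hq =>
      simp only [map_add]
      exact hp.add hq
    | mul_X p s hp =>
      simp only [map_mul, MvPolynomial.eval_X]
      exact hp.mul (hγ _ _)
  simp only [h]
  refine (hpoly p).div ?_ (pow_ne_zero _ (det_ne_zero_of_mem _))
  have := hpoly (Matrix.mvPolynomialX (Fin n) (Fin n) ℂ).det
  simp only [Matrix.eval_det_mvPolynomialX] at this
  exact this.pow k

end OneParameter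

/-! ### The Lie algebra acting on `V`, compared with `lieOrbit`. -/

namespace MatrixModel

variable {n : ℕ} {G : Subgroup (GL (Fin n) ℂ)} {V : Type*} [AddCommGroup V] [Module ℂ V]
  {ρ : Representation ℂ G V} {ι : Type*} [Fintype ι] [DecidableEq ι] (M : MatrixModel ρ ι)

/-- The endomorphism of `V` induced by a matrix. -/
def compress : Matrix ι ι ℂ →ₗ[ℂ] Module.End ℂ V where
  toFun A := M.proj.comp (A.mulVecLin.comp M.incl)
  map_add' A B := by
    ext x
    simp
  map_smul' c A := by
    ext x
    simp

theorem r_injective : Function.Injective M.r := by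
  intro g h hgh
  apply Subtype.ext
  apply Units.ext
  ext i j
  rw [← M.r_idx, hgh, M.r_idx]

theorem mem_matLie_iff_exp (hG : IsReductive G) (A : Matrix ι ι ℂ) :
    A ∈ matLie M.r ↔ ∀ t : ℂ, NormedSpace.exp (t • A) ∈ Set.range M.r :=
  PolarRep.mem_matLie_iff_exp hG M.regular M.det_eq_one M.closed A

/-- The curve `exp (t A)` lies in the group, which preserves the copy of `V`; differentiating at
`0`, so does `A`. -/
theorem mulVec_incl (hG : IsReductive G) {A : Matrix ι ι ℂ} (hA : A ∈ matLie M.r) (x : V) :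
    A *ᵥ M.incl x = M.incl (M.compress A x) := by
  rw [M.mem_matLie_iff_exp hG] at hA
  choose γ hγ using hA
  refine (Module.forall_dual_apply_eq_zero_iff ℂ (A *ᵥ M.incl x - M.incl (M.compress A x))).1
    (fun L => ?_) |> sub_eq_zero.1
  rw [map_sub, sub_eq_zero]
  have h1 := hasDerivAt_dual_mulVec (hasDerivAt_exp_zero_apply A) L (M.incl x)
  have h2 := hasDerivAt_dual_mulVec (hasDerivAt_exp_zero_apply A) (L.comp (M.incl.comp M.proj))
    (M.incl x)
  have h3 : (fun t : ℂ => (L.comp (M.incl.comp M.proj)) (NormedSpace.exp (t • A) *ᵥ M.incl x)) =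
      fun t : ℂ => L (NormedSpace.exp (t • A) *ᵥ M.incl x) := by
    funext t
    rw [← hγ, M.r_incl, LinearMap.comp_apply, LinearMap.comp_apply, M.proj_incl]
  rw [h3] at h2
  exact h1.unique h2

/-- The image of the Lie algebra of `G` in the endomorphisms of `V`. -/
def repLie : Submodule ℂ (Module.End ℂ V) := (matLie M.r).map M.compress

theorem incl_injective : Function.Injective M.incl :=
  Function.LeftInverse.injective M.proj_incl

theorem commutator_mem_repLie (hG : IsReductive G) {X Y : Module.End ℂ V} (hX : X ∈ M.repLie)
    (hY : Y ∈ M.repLie) : X * Y - Y * X ∈ M.repLie := by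
  obtain ⟨A, hA, rfl⟩ := hX
  obtain ⟨B, hB, rfl⟩ := hY
  refine ⟨A * B - B * A, commutator_mem_matLie hA hB, ?_⟩
  ext x
  apply M.incl_injective
  rw [← M.mulVec_incl hG (commutator_mem_matLie hA hB), LinearMap.sub_apply, map_sub,
    Module.End.mul_apply, Module.End.mul_apply, ← M.mulVec_incl hG hA, ← M.mulVec_incl hG hB,
    ← M.mulVec_incl hG hB, ← M.mulVec_incl hG hA, Matrix.sub_mulVec, Matrix.mulVec_mulVec,
    Matrix.mulVec_mulVec]

theorem conj_mem_repLie (hG : IsReductive G) (g : G) {X : Module.End ℂ V} (hX : X ∈ M.repLie) :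
    ρ g * X * ρ g⁻¹ ∈ M.repLie := by
  obtain ⟨A, hA, rfl⟩ := hX
  have hinv : M.r g⁻¹ * M.r g = 1 := by rw [← map_mul, inv_mul_cancel, map_one]
  have hB : M.r g * A * M.r g⁻¹ ∈ matLie M.r := by
    intro f hf
    rw [← hf g, lieDer_rightTranslate (B := A) (by rw [mul_assoc, hinv, mul_one]), hA f hf,
      map_zero]
  refine ⟨_, hB, ?_⟩
  ext x
  apply M.incl_injective
  rw [← M.mulVec_incl hG hB, Module.End.mul_apply, Module.End.mul_apply, ← M.r_incl,
    ← M.mulVec_incl hG hA, ← M.r_incl, Matrix.mulVec_mulVec, Matrix.mulVec_mulVec, mul_assoc]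

/-- One-parameter subgroups correspond under `r`: regularity makes the image of `exp (t X)`
differentiable, hence of the form `exp (t A)`; in the other direction the standard block of `exp (t
A)` is again an exponential. -/
theorem lieOrbit_eq (hG : IsReductive G) (x : V) :
    lieOrbit ρ x = M.repLie.map (LinearMap.applyₗ x) := by
  apply le_antisymm
  · refine Submodule.span_le.2 ?_
    rintro w ⟨X, γ, hγ, hw⟩
    have hγadd : ∀ s t, γ (s + t) = γ s * γ t := by
      intro s t
      apply Subtype.ext
      apply Units.ext
      rw [hγ, exp_add_smul, ← hγ, ← hγ]
      rfl
    have hγ0 : γ 0 = 1 := by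
      have := hγadd 0 0
      rw [add_zero] at this
      exact left_eq_mul.1 this
    have hγd : ∀ i j, DifferentiableAt ℂ (fun t => (γ t : GL (Fin n) ℂ).1 i j) 0 := by
      intro i j
      simp only [hγ]
      exact (hasDerivAt_exp_smul_apply X 0 i j).differentiableAt
    let A : Matrix ι ι ℂ := Matrix.of fun i j => deriv (fun t => M.r (γ t) i j) 0
    have hA : ∀ i j, HasDerivAt (fun t => M.r (γ t) i j) (A i j) 0 := fun i j =>
      (differentiableAt_regularFunction (M.regular i j) hγd).hasDerivAt
    have hexp := eq_exp_of_hasDerivAt (φ := fun t => M.r (γ t)) (by simp [hγ0])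
      (fun s t => by simp only [hγadd, map_mul]) hA
    have hAm : A ∈ matLie M.r := (M.mem_matLie_iff_exp hG A).2 fun t => ⟨γ t, hexp t⟩
    refine ⟨_, ⟨A, hAm, rfl⟩, ?_⟩
    refine (Module.forall_dual_apply_eq_zero_iff ℂ (M.compress A x - w)).1
      (fun l => ?_) |> sub_eq_zero.1
    rw [map_sub, sub_eq_zero]
    have h1 := hasDerivAt_dual_mulVec hA (l.comp M.proj) (M.incl x)
    have h2 : (fun t => (l.comp M.proj) (M.r (γ t) *ᵥ M.incl x)) = fun t => l (ρ (γ t) x) := by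
      funext t
      rw [M.r_incl, LinearMap.comp_apply, M.proj_incl]
    rw [h2] at h1
    exact h1.unique (hw l)
  · rintro _ ⟨_, ⟨A, hA, rfl⟩, rfl⟩
    have hA' := (M.mem_matLie_iff_exp hG A).1 hA
    choose γ hγ using hA'
    have hγadd : ∀ s t, γ (s + t) = γ s * γ t := fun s t => M.r_injective (by
      rw [map_mul, hγ, hγ, hγ, exp_add_smul])
    have hγ0 : γ 0 = 1 := M.r_injective (by rw [hγ]; simp)
    refine Submodule.subset_span ⟨A.submatrix M.idx M.idx, γ, ?_, fun l => ?_⟩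
    · refine eq_exp_of_hasDerivAt (φ := fun t => (γ t : GL (Fin n) ℂ).1) (by simp [hγ0])
        (fun s t => by rw [hγadd]; rfl) fun i j => ?_
      simp only [← M.r_idx, hγ]
      exact hasDerivAt_exp_zero_apply A _ _
    · have h1 := hasDerivAt_dual_mulVec (hasDerivAt_exp_zero_apply A) (l.comp M.proj) (M.incl x)
      have h2 : (fun t : ℂ => (l.comp M.proj) (NormedSpace.exp (t • A) *ᵥ M.incl x)) =
          fun t => l (ρ (γ t) x) := by
        funext t
        rw [← hγ, M.r_incl, LinearMap.comp_apply, M.proj_incl]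
      rw [h2] at h1
      exact h1

end MatrixModel

/-! ### The invariant inner product and the determinant on `Z_G(C)`. -/

section Determinant

/-- The variant of `det_eq_one_or_neg_one_of_selfAdjoint` for the inner product induced by an
injective map to an inner product space. -/
theorem det_eq_one_or_neg_one_of_injective {V E : Type*} [AddCommGroup V] [Module ℂ V]
    [FiniteDimensional ℂ V] [NormedAddCommGroup E] [InnerProductSpace ℂ E] (e : V →ₗ[ℂ] E)
    (he : Function.Injective e) (𝔨 : Submodule ℂ (Module.End ℂ V))
    (hbr : ∀ X ∈ 𝔨, ∀ Y ∈ 𝔨, X * Y - Y * X ∈ 𝔨)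
    (hadj : ∀ X ∈ 𝔨, ∃ Y ∈ 𝔨, ∀ x y, inner ℂ (e (X x)) (e y) = inner ℂ (e x) (e (Y y)))
    (v : V) (hv : ∀ X ∈ 𝔨, inner ℂ (e v) (e (X v)) = 0) (C : Submodule ℂ V) (hvC : v ∈ C)
    (hC : ∀ x ∈ C, ∀ X ∈ 𝔨, ∃ Y ∈ 𝔨, X x = Y v)
    (hdim : Module.finrank ℂ C + Module.finrank ℂ (𝔨.map (LinearMap.applyₗ v)) =
      Module.finrank ℂ V)
    (h : V ≃ₗ[ℂ] V) (hh : ∀ X ∈ 𝔨, h.conj X ∈ 𝔨) (hfix : ∀ c ∈ C, h c = c) :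
    LinearMap.det (h : V →ₗ[ℂ] V) = 1 ∨ LinearMap.det (h : V →ₗ[ℂ] V) = -1 := by
  let core : InnerProductSpace.Core ℂ V :=
    { inner := fun x y => inner ℂ (e x) (e y)
      conj_inner_symm := fun x y => inner_conj_symm _ _
      re_inner_nonneg := fun x => inner_self_nonneg
      add_left := fun x y z => by rw [map_add, inner_add_left]
      smul_left := fun x y c => by rw [map_smul, inner_smul_left]
      definite := fun x hx => he (by rw [map_zero]; exact inner_self_eq_zero.1 hx) }
  let : NormedAddCommGroup V := core.toNormedAddCommGroup
  let : InnerProductSpace ℂ V := InnerProductSpace.ofCore core.toCore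
  have hinner : ∀ x y : V, inner ℂ x y = inner ℂ (e x) (e y) := fun _ _ => rfl
  refine det_eq_one_or_neg_one_of_selfAdjoint 𝔨 hbr (fun X hX => ?_) v
    (fun X hX => (hinner _ _).trans (hv X hX)) C hvC hC hdim h hh hfix
  obtain ⟨Y, hY, hXY⟩ := hadj X hX
  have : Y = LinearMap.adjoint X := by
    have hX' : X = LinearMap.adjoint Y := by
      rw [LinearMap.eq_adjoint_iff]
      intro x y
      rw [hinner, hinner, hXY]
    rw [hX', LinearMap.adjoint_adjoint]
  rwa [← this]

variable {n : ℕ} {G : Subgroup (GL (Fin n) ℂ)} {V : Type*} [AddCommGroup V] [Module ℂ V]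

theorem continuous_polynomialFunction_comp {E : Type*} [NormedAddCommGroup E] [NormedSpace ℂ E]
    [FiniteDimensional ℂ E] (L : E →ₗ[ℂ] V) {f : V → ℂ} (hf : f ∈ polynomialFunctions V) :
    Continuous fun y => f (L y) := by
  induction hf using Algebra.adjoin_induction with
  | mem x hx =>
    obtain ⟨l, rfl⟩ := hx
    exact (l.comp L).continuous_of_finiteDimensional
  | algebraMap c => exact continuous_const
  | add x y _ _ hx hy => exact hx.add hy
  | mul x y _ _ hx hy => exact hx.mul hy

/-- A closed orbit contains a vector of minimal norm. -/
theorem IsSemisimpleVector.exists_norm_le {E : Type*} [NormedAddCommGroup E] [NormedSpace ℂ E]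
    [FiniteDimensional ℂ E] {ρ : Representation ℂ G V} {v : V} (hv : IsSemisimpleVector ρ v)
    (e : V →ₗ[ℂ] E) (he : Function.Injective e) :
    ∃ g₀ : G, ∀ g : G, ‖e (ρ g₀ v)‖ ≤ ‖e (ρ g v)‖ := by
  obtain ⟨S, hS, hSv⟩ := hv
  obtain ⟨L, hL⟩ := e.exists_leftInverse_of_injective (LinearMap.ker_eq_bot.2 he)
  have hL : ∀ x, L (e x) = x := fun x => LinearMap.congr_fun hL x
  have hproper : ProperSpace E := FiniteDimensional.proper ℂ E
  let O : Set E := Set.range fun g : G => e (ρ g v)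
  -- The Zariski closed orbit is closed in the norm topology of `E`, so it has a point nearest to
  -- `0`.
  have hO : O = {y | e (L y) = y} ∩ ⋂ f ∈ S, {y | f (L y) = 0} := by
    ext y
    simp only [Set.mem_inter_iff, Set.mem_iInter, Set.mem_ofPred_eq]
    constructor
    · rintro ⟨g, rfl⟩
      have : ρ g v ∈ {x | ∀ f ∈ S, f x = 0} := hSv ▸ ⟨g, rfl⟩
      refine ⟨by rw [hL], fun f hf => ?_⟩
      rw [hL]
      exact this f hf
    · rintro ⟨h1, h2⟩
      have : L y ∈ {x | ∀ f ∈ S, f x = 0} := h2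
      rw [← hSv] at this
      obtain ⟨g, hg⟩ := this
      exact ⟨g, by simp only at hg ⊢; rw [hg, h1]⟩
  have hclosed : IsClosed O := by
    rw [hO]
    refine (isClosed_eq (e.comp L).continuous_of_finiteDimensional continuous_id).inter
      (isClosed_biInter fun f hf => isClosed_eq (continuous_polynomialFunction_comp L (hS hf))
        continuous_const)
  obtain ⟨_, ⟨g₀, rfl⟩, hg₀⟩ := hclosed.exists_infDist_eq_dist (Set.range_nonempty _) 0
  refine ⟨g₀, fun g => ?_⟩
  have := Metric.infDist_le_dist_of_mem (x := (0 : E)) (s := O) ⟨g, rfl⟩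
  rw [hg₀, dist_zero_left, dist_zero_left] at this
  exact this

theorem rep_inv_mul (ρ : Representation ℂ G V) (g : G) : ρ g⁻¹ * ρ g = 1 := by
  rw [← map_mul, inv_mul_cancel, map_one]

theorem rep_mul_inv (ρ : Representation ℂ G V) (g : G) : ρ g * ρ g⁻¹ = 1 := by
  rw [← map_mul, mul_inv_cancel, map_one]

theorem rep_inv_apply (ρ : Representation ℂ G V) (g : G) (x : V) : ρ g⁻¹ (ρ g x) = x :=
  LinearMap.congr_fun (rep_inv_mul ρ g) x

theorem rep_apply_inv (ρ : Representation ℂ G V) (g : G) (x : V) : ρ g (ρ g⁻¹ x) = x :=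
  LinearMap.congr_fun (rep_mul_inv ρ g) x

theorem inner_toLp_mulVec {ι : Type*} [Fintype ι] (B : Matrix ι ι ℂ) (x y : ι → ℂ) :
    inner ℂ (WithLp.toLp 2 (B *ᵥ x)) (WithLp.toLp 2 y) =
      inner ℂ (WithLp.toLp 2 x) (WithLp.toLp 2 (Bᴴ *ᵥ y)) := by
  rw [EuclideanSpace.inner_toLp_toLp, EuclideanSpace.inner_toLp_toLp, Matrix.star_mulVec,
    dotProduct_comm, ← Matrix.dotProduct_mulVec, dotProduct_comm]

namespace MatrixModel

variable {ρ : Representation ℂ G V} {ι : Type*} [Fintype ι] [DecidableEq ι] (M : MatrixModel ρ ι)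

/-- The embedding of `V` in a Euclidean space given by a matrix. -/
def euclid (m : Matrix ι ι ℂ) : V →ₗ[ℂ] EuclideanSpace ℂ ι :=
  (WithLp.linearEquiv 2 ℂ (ι → ℂ)).symm.toLinearMap.comp (m.mulVecLin.comp M.incl)

theorem euclid_apply (m : Matrix ι ι ℂ) (x : V) :
    M.euclid m x = WithLp.toLp 2 (m *ᵥ M.incl x) := rfl

theorem euclid_injective {m : Matrix ι ι ℂ} (hm : m.det = 1) : Function.Injective (M.euclid m) := by
  intro x y hxy
  have h1 : m *ᵥ M.incl x = m *ᵥ M.incl y := congrArg WithLp.ofLp hxy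
  have h2 := congrArg (m⁻¹ *ᵥ ·) h1
  simp only [Matrix.mulVec_mulVec, Matrix.nonsing_inv_mul m (by simp [hm]), Matrix.one_mulVec] at h2
  exact M.incl_injective h2

/-- First order condition at a vector of minimal norm in its orbit. -/
theorem inner_euclid_eq_zero (hG : IsReductive G) (m : Matrix ι ι ℂ) {x : V}
    (hx : ∀ g : G, ‖M.euclid m x‖ ≤ ‖M.euclid m (ρ g x)‖) {X : Module.End ℂ V}
    (hX : X ∈ M.repLie) : inner ℂ (M.euclid m x) (M.euclid m (X x)) = 0 := by
  have hre : ∀ X ∈ M.repLie, (inner ℂ (M.euclid m x) (M.euclid m (X x))).re = 0 := by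
    rintro _ ⟨A, hA, rfl⟩
    have hexp := (M.mem_matLie_iff_exp hG A).1 hA
    choose γ hγ using hexp
    let c : ι → ℂ → ℂ := fun i t => (m *ᵥ (NormedSpace.exp (t • A) *ᵥ M.incl x)) i
    have hc : ∀ t i, c i t = M.euclid m (ρ (γ t) x) i := fun t i => by
      simp only [c, ← hγ, M.r_incl]
      rfl
    have hc0 : ∀ i, c i 0 = M.euclid m x i := fun i => by
      simp [c, euclid_apply]
    have hcd : ∀ i, HasDerivAt (c i) (M.euclid m (M.compress A x) i) 0 := fun i => by
      have := hasDerivAt_dual_mulVec (hasDerivAt_exp_zero_apply A)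
        ((LinearMap.proj i).comp m.mulVecLin) (M.incl x)
      simp only [LinearMap.comp_apply, Matrix.mulVecLin_apply, M.mulVec_incl hG hA] at this
      exact this
    let φ : ℝ → ℝ := fun t => ∑ i, ‖c i t‖ ^ 2
    have hφ : ∀ t : ℝ, φ t = ‖M.euclid m (ρ (γ t) x)‖ ^ 2 := fun t => by
      rw [EuclideanSpace.norm_sq_eq]
      simp only [φ, hc]
    have hφ0 : φ 0 = ‖M.euclid m x‖ ^ 2 := by
      rw [EuclideanSpace.norm_sq_eq]
      simp only [φ, Complex.ofReal_zero, hc0]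
    have hloc : IsLocalMin φ 0 := Filter.Eventually.of_forall fun t => by
      rw [hφ0, hφ]
      exact pow_le_pow_left₀ (norm_nonneg _) (hx _) 2
    have hd : HasDerivAt φ
        (∑ i, 2 * inner ℝ (M.euclid m x i) (M.euclid m (M.compress A x) i)) 0 := by
      refine HasDerivAt.fun_sum fun i _ => ?_
      have h1 : HasDerivAt (c i) (M.euclid m (M.compress A x) i) ((0 : ℝ) : ℂ) := by
        simpa using hcd i
      have h2 := h1.comp_ofReal.norm_sq
      simpa [hc0] using h2
    have h0 := hloc.hasDerivAt_eq_zero hd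
    rw [← Finset.mul_sum] at h0
    rw [PiLp.inner_apply, Complex.re_sum]
    exact (mul_eq_zero.1 h0).resolve_left two_ne_zero
  refine Complex.ext (hre X hX) ?_
  have h := hre (Complex.I • X) (M.repLie.smul_mem _ hX)
  rw [LinearMap.smul_apply, map_smul, inner_smul_right, Complex.I_mul_re] at h
  simpa using h

end MatrixModel

/-- Elements of the pointwise stabilizer of a Cartan subspace of a stable polar representation have
determinant `±1`. -/
theorem det_eq_one_or_neg_one_of_fix [FiniteDimensional ℂ V] (hG : IsConnectedReductiveGroup G)
    {ρ : Representation ℂ G V} (hρ : IsRational ρ) {C : Submodule ℂ V} (hC : IsCartanSubspace ρ C)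
    (hstable : IsStable ρ C) (g : G) (hg : ∀ c ∈ C, ρ g c = c) :
    LinearMap.det (ρ g) = 1 ∨ LinearMap.det (ρ g) = -1 := by
  obtain ⟨M⟩ := exists_matrixModel hG.isClosed hρ
  have hred := hG.isReductive
  obtain ⟨v, hvs, hCv, -⟩ := hC
  have hmemC : ∀ x, x ∈ C ↔ lieOrbit ρ x ≤ lieOrbit ρ v := fun x => by
    rw [← SetLike.mem_coe, hCv, Set.mem_ofPred_eq]
  have hvC : v ∈ C := (hmemC v).2 le_rfl
  -- Every `𝔤 · c` lies in `𝔤 · v`, and `v` itself belongs to `C`.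
  have hsup : (⨆ c ∈ C, lieOrbit ρ c : Submodule ℂ V) = lieOrbit ρ v :=
    le_antisymm (iSup₂_le fun c hc => (hmemC c).1 hc) (le_iSup₂_of_le v hvC le_rfl)
  rw [IsStable, hsup, M.lieOrbit_eq hred] at hstable
  obtain ⟨m, hm, hmadj⟩ := exists_conjTranspose_mem_matLie hred M.regular M.det_eq_one
  have hmm : m⁻¹ * m = 1 := Matrix.nonsing_inv_mul _ (by simp [hm])
  have hmm' : m * m⁻¹ = 1 := Matrix.mul_nonsing_inv _ (by simp [hm])
  have hadj : ∀ X ∈ M.repLie, ∃ Y ∈ M.repLie, ∀ x y,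
      inner ℂ (M.euclid m (X x)) (M.euclid m y) = inner ℂ (M.euclid m x) (M.euclid m (Y y)) := by
    rintro _ ⟨A, hA, rfl⟩
    refine ⟨_, ⟨_, hmadj A hA, rfl⟩, fun x y => ?_⟩
    rw [M.euclid_apply, M.euclid_apply, M.euclid_apply, M.euclid_apply, ← M.mulVec_incl hred hA,
      ← M.mulVec_incl hred (hmadj A hA), Matrix.mulVec_mulVec, Matrix.mulVec_mulVec,
      ← mul_assoc, ← mul_assoc, hmm', one_mul]
    have h1 : m * A = (m * A * m⁻¹) * m := by rw [mul_assoc (m * A), hmm, mul_one]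
    conv_lhs => rw [h1]
    rw [← Matrix.mulVec_mulVec _ (m * A * m⁻¹), ← Matrix.mulVec_mulVec _ (m * A * m⁻¹)ᴴ,
      inner_toLp_mulVec]
  obtain ⟨g₀, hg₀⟩ := hvs.exists_norm_le (M.euclid m) (M.euclid_injective hm)
  have hconj : ∀ g, ∀ X ∈ M.repLie, ρ g * X * ρ g⁻¹ ∈ M.repLie := fun g X hX =>
    M.conj_mem_repLie hred g hX
  let h : V ≃ₗ[ℂ] V := LinearEquiv.ofLinearMap (ρ g) (ρ g⁻¹) (rep_mul_inv ρ g) (rep_inv_mul ρ g)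
  have hρinj : Function.Injective (ρ g₀) := Function.LeftInverse.injective (rep_inv_apply ρ g₀)
  -- The vector of minimal norm is `ρ g₀ v`. Pulling the inner product back along `ρ g₀`, instead of
  -- moving `v`, leaves `v`, `C` and `g` as they are.
  refine det_eq_one_or_neg_one_of_injective ((M.euclid m).comp (ρ g₀))
    ((M.euclid_injective hm).comp hρinj) M.repLie
    (fun X hX Y hY => M.commutator_mem_repLie hred hX hY) (fun X hX => ?_) v (fun X hX => ?_) C hvC
    (fun x hx X hX => ?_) hstable h (fun X hX => hconj g X hX) hg
  · obtain ⟨Y, hY, hXY⟩ := hadj _ (hconj g₀ X hX)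
    refine ⟨ρ g₀⁻¹ * Y * ρ g₀, by simpa using hconj g₀⁻¹ Y hY, fun x y => ?_⟩
    have := hXY (ρ g₀ x) (ρ g₀ y)
    simpa only [LinearMap.comp_apply, Module.End.mul_apply, rep_inv_apply, rep_apply_inv] using this
  · have := M.inner_euclid_eq_zero hred m (x := ρ g₀ v) (fun g => by
      rw [← Module.End.mul_apply, ← map_mul]; exact hg₀ _) (hconj g₀ X hX)
    simpa only [LinearMap.comp_apply, Module.End.mul_apply, rep_inv_apply] using this
  · have h1 := (hmemC x).1 hx
    rw [M.lieOrbit_eq hred, M.lieOrbit_eq hred] at h1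
    obtain ⟨Y, hY, hYX⟩ := h1 ⟨X, hX, rfl⟩
    exact ⟨Y, hY, hYX.symm⟩

/-- The determinant is trivial on the identity component of the pointwise stabilizer. -/
theorem det_eq_one_of_mem_identityComponent [FiniteDimensional ℂ V] {ρ : Representation ℂ G V}
    (hρ : IsRational ρ) {C : Submodule ℂ V}
    (hdet : ∀ g : G, (∀ c ∈ C, ρ g c = c) → LinearMap.det (ρ g) = 1 ∨ LinearMap.det (ρ g) = -1)
    (g : G) (hg : (g : GL (Fin n) ℂ) ∈ @connectedComponentIn _ (zariski n) (centralizer ρ C) 1) :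
    LinearMap.det (ρ g) = 1 := by
  let := zariski n
  obtain ⟨p, k, hp⟩ := det_rep_mem_regularFunctions hρ
  simp only at hp
  let d : MvPolynomial (Fin n × Fin n) ℂ := (Matrix.mvPolynomialX (Fin n) (Fin n) ℂ).det ^ k
  have hd : ∀ g : GL (Fin n) ℂ, MvPolynomial.eval (fun ij => g.1 ij.1 ij.2) d = g.1.det ^ k := by
    intro g
    rw [map_pow, Matrix.eval_det_mvPolynomialX]
    rfl
  have hval : ∀ (g : G) (c : ℂ), LinearMap.det (ρ g) = c ↔
      MvPolynomial.eval (fun ij => (g : GL (Fin n) ℂ).1 ij.1 ij.2)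
        (p - MvPolynomial.C c * d) = 0 := by
    intro g c
    rw [hp, div_eq_iff (pow_ne_zero _ (det_ne_zero_of_mem _)), map_sub, map_mul, hd,
      MvPolynomial.eval_C, sub_eq_zero]
  -- On `G` this is `{det ρ ≠ c}`, with the denominator cleared so that it is a basic open set of
  -- `GL_n`.
  let U : ℂ → Set (GL (Fin n) ℂ) := fun c =>
    {g | MvPolynomial.eval (fun ij => g.1 ij.1 ij.2) (p - MvPolynomial.C c * d) ≠ 0}
  have hU : ∀ c, IsOpen (U c) := fun c =>
    TopologicalSpace.isOpen_generateFrom_of_mem ⟨_, rfl⟩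
  have hcent : ∀ x ∈ connectedComponentIn (centralizer ρ C : Set (GL (Fin n) ℂ)) 1,
      ∃ y : G, (y : GL (Fin n) ℂ) = x ∧ ∀ c ∈ C, ρ y c = c := by
    intro x hx
    obtain ⟨y, hy, rfl⟩ := connectedComponentIn_subset _ _ hx
    exact ⟨y, rfl, hy⟩
  have hpre : IsPreconnected (connectedComponentIn (centralizer ρ C : Set (GL (Fin n) ℂ)) 1) :=
    isPreconnected_connectedComponentIn
  by_contra hne
  obtain ⟨x, hx, hx1, hx2⟩ := hpre (U 1) (U (-1)) (hU 1) (hU (-1)) (by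
      intro x hx
      obtain ⟨y, rfl, hy⟩ := hcent x hx
      by_contra hn
      simp only [Set.mem_union, not_or, U, Set.mem_ofPred_eq, not_not] at hn
      have h1 := (hval y 1).2 hn.1
      have h2 := (hval y (-1)).2 hn.2
      rw [h1] at h2
      norm_num at h2)
    ⟨g, hg, fun h0 => hne ((hval g 1).2 h0)⟩
    ⟨1, mem_connectedComponentIn (Subgroup.one_mem _), fun h0 => by
      have := (hval 1 (-1)).2 h0
      rw [map_one, map_one] at this
      norm_num at this⟩
  obtain ⟨y, rfl, hy⟩ := hcent x hx
  rcases hdet y hy with h | h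
  · exact hx1 ((hval y 1).1 h)
  · exact hx2 ((hval y (-1)).1 h)

end Determinant

end PolarRep

end

/-! ### The determinant character on the component group. -/

theorem mainTheorem12 {n : ℕ} (G : Subgroup (GL (Fin n) ℂ))
    (hG : PolarRep.IsConnectedReductiveGroup G)
    {V : Type*} [AddCommGroup V] [Module ℂ V] [FiniteDimensional ℂ V]
    (ρ : Representation ℂ G V) (hρ : PolarRep.IsRational ρ)
    (C : Submodule ℂ V) (hC : PolarRep.IsCartanSubspace ρ C) (hstable : PolarRep.IsStable ρ C) :
    (∀ g : G, (∀ c ∈ C, ρ g c = c) → LinearMap.det (ρ g) = 1 ∨ LinearMap.det (ρ g) = -1) ∧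
    ∃! τ : PolarRep.inertia ρ C →* ℤˣ,
      ∀ (g : G) (hg : (g : GL (Fin n) ℂ) ∈ PolarRep.centralizer ρ C),
        (((τ (QuotientGroup.mk ⟨g, hg⟩) : ℤˣ) : ℤ) : ℂ) = LinearMap.det (ρ g) := by
  have hdet := PolarRep.det_eq_one_or_neg_one_of_fix hG hρ hC hstable
  refine ⟨hdet, ?_⟩
  have hmem : ∀ z : PolarRep.centralizer ρ C, ∃ y : G, (y : GL (Fin n) ℂ) = z ∧
      ∀ c ∈ C, ρ y c = c := by
    rintro ⟨_, y, hy, rfl⟩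
    exact ⟨y, rfl, hy⟩
  -- `centralizer` lives in `GL_n` while `ρ` is defined on `G`. The lift `s` is unique, hence
  -- multiplicative.
  choose s hs hsC using hmem
  have hu : ∀ z, ∃ u : ℤˣ, ((u : ℤ) : ℂ) = LinearMap.det (ρ (s z)) := fun z => by
    rcases hdet _ (hsC z) with h | h
    · exact ⟨1, by simp [h]⟩
    · exact ⟨-1, by simp [h]⟩
  choose u hu using hu
  have hinj : Function.Injective fun a : ℤˣ => ((a : ℤ) : ℂ) := fun a b h =>
    Units.ext (Int.cast_injective h)
  have hsmul : ∀ z w, s (z * w) = s z * s w := fun z w => Subtype.ext (by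
    rw [hs, Subgroup.coe_mul, Subgroup.coe_mul, hs, hs])
  let u' : PolarRep.centralizer ρ C →* ℤˣ := MonoidHom.mk' u fun z w => hinj (by
    simp only [Units.val_mul, Int.cast_mul, hu, hsmul, map_mul])
  have hker : ∀ z ∈ PolarRep.identityComponent (PolarRep.centralizer ρ C), u' z = 1 := by
    intro z hz
    refine hinj ((hu z).trans ?_)
    rw [PolarRep.det_eq_one_of_mem_identityComponent hρ hdet (s z) (by rw [hs]; exact hz)]
    simp
  have hsg : ∀ (g : G) (hg : (g : GL (Fin n) ℂ) ∈ PolarRep.centralizer ρ C), s ⟨g, hg⟩ = g :=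
    fun g hg => Subtype.ext (hs _)
  refine ⟨QuotientGroup.lift _ u' hker, fun g hg => ?_, fun τ hτ => ?_⟩
  · exact (hu _).trans (by rw [hsg])
  · refine MonoidHom.ext fun q => ?_
    obtain ⟨z, rfl⟩ := QuotientGroup.mk_surjective q
    refine hinj ?_
    have hz : z = ⟨(s z : GL (Fin n) ℂ), by rw [hs]; exact z.2⟩ := Subtype.ext (hs z).symm
    have h1 := hτ (s z) (by rw [hs]; exact z.2)
    rw [← hz] at h1
    exact h1.trans (hu z).symm
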